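/- Let $p$ be an odd prime, let $m\ge 2$, $n\ge 1$ and $1\le r\le \min\{n,m-1\}$ be integers, and let \[ G=\langle x,y : x^{p^m}=1,\ y^{p^n}=1,\ yxy^{-1}=x^{1+p^{m-r}}\rangle .\] Let $u$ be a generator of $(\mathbb{Z}/p^m\mathbb{Z})^\times$, and let $\alpha,\beta,\delta\in\mathrm{Aut}(G)$ be the automorphisms with $\alpha(x)=x^u$, $\alpha(y)=y$; $\beta(x)=x$, $\beta(y)=x^{p^{\max\{m-n,0\}}}y$; $\delta(x)=x$, $\delta(y)=y^{1+p^r}$. Put \[\widetilde\alpha=\alpha^{(p-1)p^{m-r-1}},\quad \widetilde\beta=\beta^{p^{\min\{m,n\}-r}},\quad \widetilde\delta=\delta^{p^{\max\{n-2r,0\}}}.\] Call a triplet $(a,b,d)\in\mathbb{Z}^3$ admissible if there is a map $\Gamma:G\to\mathrm{Aut}(G)$ with $\Gamma(x)=\widetilde\beta^{\,b}$ and $\Gamma(y)=\widetilde\alpha^{\,a}\widetilde\delta^{\,d}$ such that $\Gamma(\sigma\tau)=\Gamma(\tau)\Gamma(\sigma)$ and $\Gamma(\varphi(\sigma))=\varphi\,\Gamma(\sigma)\,\varphi^{-1}$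 for all $\sigma,\tau\in G$ and $\varphi\in\mathrm{Aut}(G)$. Let $\mathbb{M}=p^r\mathbb{Z}\times p^r\mathbb{Z}\times p^{\min\{r,n-r\}}\mathbb{Z}$. Then the number of classes modulo $\mathbb{M}$ of admissible triplets is \[\begin{cases} 2p^{m-r+\min\{r,n-r\}} & \text{if } m\le n \text{ and } m-r<r,\\ p^{r+\min\{r,n-r\}} & \text{if } m\le n \text{ and } r\le m-r,\\ p^{r} & \text{if } n\le m-r. \end{cases}\] -/

import Mathlib

namespace Metacyclic

/-- The relators of the presentation
`⟨x, y : x ^ (p ^ m) = 1, y ^ (p ^ n) = 1, y x y⁻¹ = x ^ (1 + p ^ (m - r))⟩`;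
the letter `0` stands for `x` and the letter `1` for `y`. -/
def rels (p m n r : ℕ) : Set (FreeGroup (Fin 2)) :=
  {FreeGroup.of 0 ^ p ^ m,
   FreeGroup.of 1 ^ p ^ n,
   FreeGroup.of 1 * FreeGroup.of 0 * (FreeGroup.of 1)⁻¹ *
     (FreeGroup.of 0 ^ (1 + p ^ (m - r)))⁻¹}

/-- The split metacyclic `p`-group given by the presentation above. -/
abbrev G (p m n r : ℕ) : Type := PresentedGroup (rels p m n r)

/-- The generator `x`. -/
def x (p m n r : ℕ) : G p m n r := PresentedGroup.of 0

/-- The generator `y`. -/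
def y (p m n r : ℕ) : G p m n r := PresentedGroup.of 1

section Basic

variable {p m n r : ℕ}

theorem x_pow : x p m n r ^ p ^ m = 1 :=
  PresentedGroup.one_of_mem (rels := rels p m n r) (x := FreeGroup.of 0 ^ p ^ m)
    (by simp [rels])

theorem y_pow : y p m n r ^ p ^ n = 1 :=
  PresentedGroup.one_of_mem (rels := rels p m n r) (x := FreeGroup.of 1 ^ p ^ n)
    (by simp [rels])

theorem conj_x : y p m n r * x p m n r * (y p m n r)⁻¹ = x p m n r ^ (1 + p ^ (m - r)) :=
  mul_inv_eq_one.mp <|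
    PresentedGroup.one_of_mem (rels := rels p m n r)
      (x := FreeGroup.of 1 * FreeGroup.of 0 * (FreeGroup.of 1)⁻¹ *
        (FreeGroup.of 0 ^ (1 + p ^ (m - r)))⁻¹) (by simp [rels])

/-- The homomorphism out of `G` with prescribed values on `x` and `y`. -/
def lift {H : Type*} [Group H] (X Y : H) (hX : X ^ p ^ m = 1) (hY : Y ^ p ^ n = 1)
    (hXY : Y * X * Y⁻¹ = X ^ (1 + p ^ (m - r))) : G p m n r →* H :=
  PresentedGroup.toGroup (f := ![X, Y]) (by
    intro w hw
    rcases hw with rfl | rfl | rfl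
    · simpa using hX
    · simpa using hY
    · simpa [mul_inv_eq_one] using hXY)

section
variable {H : Type*} [Group H] (X Y : H) (hX : X ^ p ^ m = 1) (hY : Y ^ p ^ n = 1)
    (hXY : Y * X * Y⁻¹ = X ^ (1 + p ^ (m - r)))

@[simp] theorem lift_x : lift X Y hX hY hXY (x p m n r) = X := by
  simp [lift, x, PresentedGroup.toGroup.of]

@[simp] theorem lift_y : lift X Y hX hY hXY (y p m n r) = Y := by
  simp [lift, y, PresentedGroup.toGroup.of]
end

theorem hom_ext {H : Type*} [Group H] {f g : G p m n r →* H}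
    (hx : f (x p m n r) = g (x p m n r)) (hy : f (y p m n r) = g (y p m n r)) : f = g := by
  apply PresentedGroup.ext
  intro i
  fin_cases i
  · exact hx
  · exact hy

theorem x_pow_congr {k l : ℕ} (h : k ≡ l [MOD p ^ m]) : x p m n r ^ k = x p m n r ^ l := by
  rw [pow_eq_pow_iff_modEq]
  exact h.of_dvd (orderOf_dvd_of_pow_eq_one x_pow)

theorem y_pow_congr {k l : ℕ} (h : k ≡ l [MOD p ^ n]) : y p m n r ^ k = y p m n r ^ l := by
  rw [pow_eq_pow_iff_modEq]
  exact h.of_dvd (orderOf_dvd_of_pow_eq_one y_pow)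

theorem conj_pow_x (l : ℕ) :
    y p m n r ^ l * x p m n r * (y p m n r ^ l)⁻¹ = x p m n r ^ (1 + p ^ (m - r)) ^ l := by
  induction l with
  | zero => simp
  | succ l ih =>
    have : y p m n r ^ (l + 1) * x p m n r * (y p m n r ^ (l + 1))⁻¹ =
        y p m n r ^ l * (y p m n r * x p m n r * (y p m n r)⁻¹) * (y p m n r ^ l)⁻¹ := by
      rw [pow_succ]; group
    rw [this, conj_x, ← conj_pow, ih, ← pow_mul, ← pow_succ]

/-- `(x ^ k y) ^ l = x ^ (k (1 + z + ⋯ + z ^ (l - 1))) y ^ l` with `z = 1 + p ^ (m - r)`. -/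
theorem xky_pow (k : ℤ) (l : ℕ) :
    (x p m n r ^ k * y p m n r) ^ l =
      x p m n r ^ (k * ((∑ i ∈ Finset.range l, (1 + p ^ (m - r)) ^ i : ℕ) : ℤ)) *
        y p m n r ^ l := by
  induction l with
  | zero => simp
  | succ l ih =>
    have h : y p m n r ^ l * x p m n r ^ k =
        x p m n r ^ (k * (((1 + p ^ (m - r)) ^ l : ℕ) : ℤ)) * y p m n r ^ l := by
      rw [← mul_inv_eq_iff_eq_mul, ← conj_zpow, conj_pow_x, mul_comm, zpow_mul, zpow_natCast]
    rw [pow_succ, ih, Finset.sum_range_succ, Nat.cast_add, mul_add, zpow_add, pow_succ,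
      mul_assoc, ← mul_assoc (y p m n r ^ l), h]
    simp only [mul_assoc]

theorem pow_dvd_geom_sum {z : ℕ} (hz : z ≡ 1 [MOD p]) (t : ℕ) :
    p ^ t ∣ ∑ i ∈ Finset.range (p ^ t), z ^ i := by
  induction t with
  | zero => simp
  | succ t ih =>
    have h1 : ∀ (a b : ℕ), ∑ i ∈ Finset.range (a * b), z ^ i =
        (∑ i ∈ Finset.range a, z ^ i) * ∑ j ∈ Finset.range b, (z ^ a) ^ j := by
      intro a b
      induction b with
      | zero => simp
      | succ b ihb =>
        rw [Nat.mul_succ, Finset.sum_range_add, ihb, Finset.sum_range_succ, mul_add]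
        congr 1
        simp_rw [pow_add, ← pow_mul]
        rw [← Finset.mul_sum, mul_comm]
    rw [pow_succ, h1]
    refine mul_dvd_mul ih ?_
    have h2 : ∀ b : ℕ, ∑ j ∈ Finset.range b, (z ^ p ^ t) ^ j ≡ b [MOD p] := by
      intro b
      induction b with
      | zero => rfl
      | succ b ihb =>
        rw [Finset.sum_range_succ]
        refine ihb.add ?_
        have := (hz.pow (p ^ t)).pow b
        simpa using this
    exact (Nat.modEq_zero_iff_dvd).mp ((h2 p).trans (by simp [Nat.ModEq]))

theorem pow_pow_modEq_one {a s : ℕ} (hs : 1 ≤ s) (t : ℕ) :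
    (1 + a * p ^ s) ^ p ^ t ≡ 1 [MOD p ^ (s + t)] := by
  have hz : 1 + a * p ^ s ≡ 1 [MOD p] := by
    have : p ∣ a * p ^ s := Dvd.dvd.mul_left (dvd_pow_self p (by omega)) a
    simpa using (Nat.ModEq.refl 1).add ((Nat.modEq_zero_iff_dvd).mpr this)
  obtain ⟨c, hc⟩ := pow_dvd_geom_sum hz t
  have h := Commute.geom_sum₂_mul (Commute.all (1 + (a * p ^ s : ℤ)) 1) (p ^ t)
  simp only [one_pow, mul_one] at h
  have hc' : (∑ i ∈ Finset.range (p ^ t), (1 + (a * p ^ s : ℤ)) ^ i) = p ^ t * c := by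
    exact_mod_cast hc
  rw [hc'] at h
  rw [← Int.natCast_modEq_iff]
  refine Int.ModEq.symm ((Int.modEq_iff_dvd).mpr ⟨c * a, ?_⟩)
  push_cast
  rw [← h]
  ring

end Basic

section Automorphisms

variable (p m n r : ℕ)

/-- The endomorphism `x ↦ x ^ u`, `y ↦ y`. -/
def alphaHom (u : ZMod (p ^ m)) : G p m n r →* G p m n r :=
  lift (x p m n r ^ u.val) (y p m n r)
    (by rw [← pow_mul, mul_comm, pow_mul, x_pow, one_pow]) y_pow
    (by rw [← conj_pow, conj_x, ← pow_mul, ← pow_mul, mul_comm])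

theorem alphaHom_comp (u v : ZMod (p ^ m)) (h : u * v = 1) :
    (alphaHom p m n r u).comp (alphaHom p m n r v) = MonoidHom.id _ := by
  apply hom_ext
  · have : u.val * v.val ≡ 1 [MOD p ^ m] := by
      have h1 := congrArg ZMod.val h
      rw [ZMod.val_mul, ZMod.val_one_eq_one_mod] at h1
      exact h1
    simp [alphaHom, ← pow_mul, x_pow_congr this]
  · simp [alphaHom]

/-- The automorphism `α` with `α x = x ^ u` and `α y = y`. -/
def alpha (u : (ZMod (p ^ m))ˣ) : MulAut (G p m n r) :=
  MonoidHom.toMulEquiv (alphaHom p m n r u) (alphaHom p m n r (u⁻¹ : (ZMod (p ^ m))ˣ))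
    (alphaHom_comp p m n r _ _ (by simp)) (alphaHom_comp p m n r _ _ (by simp))

/-- The endomorphism `x ↦ x`, `y ↦ x ^ k y`, where `p ^ max (m - n, 0)` divides `k`. -/
def betaHom (hrm : r < m) (k : ℤ) (hk : (p : ℤ) ^ (m - n) ∣ k) : G p m n r →* G p m n r :=
  lift (x p m n r) (x p m n r ^ k * y p m n r) x_pow
    (by
      rw [xky_pow, y_pow, mul_one]
      have hz : 1 + p ^ (m - r) ≡ 1 [MOD p] := by
        have : p ∣ p ^ (m - r) := dvd_pow_self p (by omega)
        simpa using (Nat.ModEq.refl 1).add ((Nat.modEq_zero_iff_dvd).mpr this)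
      have h2 := Int.natCast_dvd_natCast.mpr (pow_dvd_geom_sum hz n)
      push_cast at h2
      have h3 : (p : ℤ) ^ m ∣ k *
          ((∑ i ∈ Finset.range (p ^ n), (1 + p ^ (m - r)) ^ i : ℕ) : ℤ) := by
        refine (pow_dvd_pow (p : ℤ) (show m ≤ (m - n) + n by omega)).trans ?_
        rw [pow_add]
        push_cast
        exact mul_dvd_mul hk h2
      obtain ⟨c, hc⟩ := h3
      rw [hc, zpow_mul]
      have : x p m n r ^ ((p : ℤ) ^ m) = 1 := by exact_mod_cast x_pow (p := p) (m := m)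
      rw [this, one_zpow])
    (by
      have : x p m n r ^ k * y p m n r * x p m n r * (x p m n r ^ k * y p m n r)⁻¹ =
          x p m n r ^ k * (y p m n r * x p m n r * (y p m n r)⁻¹) * (x p m n r ^ k)⁻¹ := by
        group
      rw [this, conj_x]
      group)

/-- The automorphism `β` with `β x = x` and `β y = x ^ (p ^ max (m - n, 0)) y`. -/
def beta (hrm : r < m) : MulAut (G p m n r) :=
  MonoidHom.toMulEquiv (betaHom p m n r hrm (p ^ (m - n)) dvd_rfl)
    (betaHom p m n r hrm (-p ^ (m - n)) (dvd_neg.mpr dvd_rfl))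
    (by apply hom_ext <;> simp [betaHom])
    (by apply hom_ext <;> simp [betaHom])

/-- The endomorphism `x ↦ x`, `y ↦ y ^ w`, where `w ≡ 1` modulo `p ^ r`. -/
def deltaHom (hrm : r < m) (w : ℕ) (hw : ∃ c, w = 1 + c * p ^ r) : G p m n r →* G p m n r :=
  lift (x p m n r) (y p m n r ^ w) x_pow
    (by rw [← pow_mul, mul_comm, pow_mul, y_pow, one_pow])
    (by
      rw [conj_pow_x]
      apply x_pow_congr
      obtain ⟨c, rfl⟩ := hw
      have h := pow_pow_modEq_one (p := p) (a := 1) (show 1 ≤ m - r by omega) r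
      rw [one_mul, Nat.sub_add_cancel hrm.le] at h
      rw [pow_add, pow_one, mul_comm c, pow_mul]
      simpa using (Nat.ModEq.refl (1 + p ^ (m - r))).mul (h.pow c))

theorem deltaHom_comp (hrm : r < m) (v w : ℕ) (hv : ∃ c, v = 1 + c * p ^ r)
    (hw : ∃ c, w = 1 + c * p ^ r) (h : v * w ≡ 1 [MOD p ^ n]) :
    (deltaHom p m n r hrm v hv).comp (deltaHom p m n r hrm w hw) = MonoidHom.id _ := by
  apply hom_ext
  · simp [deltaHom]
  · simp [deltaHom, ← pow_mul, y_pow_congr h]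

theorem exists_eq_pow (k : ℕ) : ∃ c, (1 + p ^ r) ^ k = 1 + c * p ^ r := by
  induction k with
  | zero => exact ⟨0, by simp⟩
  | succ k ih =>
    obtain ⟨c, hc⟩ := ih
    exact ⟨c + 1 + c * p ^ r, by rw [pow_succ, hc]; ring⟩

theorem one_add_pow_inv (hp : 0 < p) (hr : 1 ≤ r) :
    (1 + p ^ r) * (1 + p ^ r) ^ (p ^ n - 1) ≡ 1 [MOD p ^ n] := by
  rw [← pow_succ', Nat.sub_add_cancel (Nat.one_le_pow _ _ hp)]
  have h := pow_pow_modEq_one (p := p) (a := 1) hr n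
  rw [one_mul] at h
  exact h.of_dvd (pow_dvd_pow p (by omega))

/-- The automorphism `δ` with `δ x = x` and `δ y = y ^ (1 + p ^ r)`. -/
def delta (hp : 0 < p) (hr : 1 ≤ r) (hrm : r < m) : MulAut (G p m n r) :=
  MonoidHom.toMulEquiv (deltaHom p m n r hrm (1 + p ^ r) ⟨1, by simp⟩)
    (deltaHom p m n r hrm ((1 + p ^ r) ^ (p ^ n - 1)) (exists_eq_pow p r _))
    (deltaHom_comp p m n r hrm _ _ _ _ (by rw [mul_comm]; exact one_add_pow_inv p n r hp hr))
    (deltaHom_comp p m n r hrm _ _ _ _ (one_add_pow_inv p n r hp hr))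

variable {p m n r}

theorem alpha_x (u : (ZMod (p ^ m))ˣ) :
    alpha p m n r u (x p m n r) = x p m n r ^ (u : ZMod (p ^ m)).val := by
  simp [alpha, alphaHom, MonoidHom.toMulEquiv_apply]

theorem alpha_y (u : (ZMod (p ^ m))ˣ) : alpha p m n r u (y p m n r) = y p m n r := by
  simp [alpha, alphaHom, MonoidHom.toMulEquiv_apply]

theorem beta_x (hrm : r < m) : beta p m n r hrm (x p m n r) = x p m n r := by
  simp [beta, betaHom, MonoidHom.toMulEquiv_apply]

theorem beta_y (hrm : r < m) :
    beta p m n r hrm (y p m n r) = x p m n r ^ p ^ (m - n) * y p m n r := by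
  have h : beta p m n r hrm (y p m n r) = x p m n r ^ (p ^ (m - n) : ℤ) * y p m n r :=
    by simp [beta, betaHom, MonoidHom.toMulEquiv_apply]
  rw [h]
  norm_cast

theorem delta_x (hp : 0 < p) (hr : 1 ≤ r) (hrm : r < m) :
    delta p m n r hp hr hrm (x p m n r) = x p m n r := by
  simp [delta, deltaHom, MonoidHom.toMulEquiv_apply]

theorem delta_y (hp : 0 < p) (hr : 1 ≤ r) (hrm : r < m) :
    delta p m n r hp hr hrm (y p m n r) = y p m n r ^ (1 + p ^ r) := by
  simp [delta, deltaHom, MonoidHom.toMulEquiv_apply]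

end Automorphisms

/-- `Γ : H → Aut H` is an antihomomorphism. -/
def IsAntihom {H : Type*} [Group H] (Γ : H → MulAut H) : Prop :=
  ∀ σ τ : H, Γ (σ * τ) = Γ τ * Γ σ

/-- `Γ : H → Aut H` is equivariant for the canonical action of `Aut H` on `H` and the
conjugation action of `Aut H` on itself. -/
def IsEquivariant {H : Type*} [Group H] (Γ : H → MulAut H) : Prop :=
  ∀ (φ : MulAut H) (σ : H), Γ (φ σ) = φ * Γ σ * φ⁻¹

section Triplets

variable (p m n r : ℕ)

/-- `α ^ ((p - 1) p ^ (m - r - 1))` -/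
def alphaTilde (u : (ZMod (p ^ m))ˣ) : MulAut (G p m n r) :=
  alpha p m n r u ^ ((p - 1) * p ^ (m - r - 1))

/-- `β ^ (p ^ (min (m, n) - r))` -/
def betaTilde (hrm : r < m) : MulAut (G p m n r) :=
  beta p m n r hrm ^ p ^ (min m n - r)

/-- `δ ^ (p ^ max (n - 2 r, 0))` -/
def deltaTilde (hp : 0 < p) (hr : 1 ≤ r) (hrm : r < m) : MulAut (G p m n r) :=
  delta p m n r hp hr hrm ^ p ^ (n - 2 * r)

/-- The triplet `t = (a, b, d)` is admissible: the assignment `x ↦ β̃ ^ b`, `y ↦ α̃ ^ a δ̃ ^ d`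
extends to an `Aut G`-equivariant antihomomorphism from `G` to `Aut G`. -/
def Admissible (hp : 0 < p) (hr : 1 ≤ r) (hrm : r < m) (u : (ZMod (p ^ m))ˣ)
    (t : ℤ × ℤ × ℤ) : Prop :=
  ∃ Γ : G p m n r → MulAut (G p m n r), IsAntihom Γ ∧
    Γ (x p m n r) = betaTilde p m n r hrm ^ t.2.1 ∧
    Γ (y p m n r) =
      alphaTilde p m n r u ^ t.1 * deltaTilde p m n r hp hr hrm ^ t.2.2 ∧
    IsEquivariant Γ

/-- The subgroup `p ^ r ℤ × p ^ r ℤ × p ^ min (r, n - r) ℤ` of `ℤ × ℤ × ℤ`. -/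
def modulus : AddSubgroup (ℤ × ℤ × ℤ) :=
  (AddSubgroup.zmultiples ((p : ℤ) ^ r)).prod
    ((AddSubgroup.zmultiples ((p : ℤ) ^ r)).prod
      (AddSubgroup.zmultiples ((p : ℤ) ^ min r (n - r))))

/-- The classes modulo `modulus` of the admissible triplets. -/
def admissibleClasses (hp : 0 < p) (hr : 1 ≤ r) (hrm : r < m) (u : (ZMod (p ^ m))ˣ) :
    Set ((ℤ × ℤ × ℤ) ⧸ modulus p n r) :=
  (fun t : ℤ × ℤ × ℤ => (t : (ℤ × ℤ × ℤ) ⧸ modulus p n r)) ''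
    {t | Admissible p m n r hp hr hrm u t}

end Triplets

end Metacyclic

/-! Write N = p^(m-r). Every element of `G` is uniquely x^k y^l with k modulo p^m and l modulo p^n
(`x_zpow_mul_y_pow_eq_iff`), so equalities in `G` and in `Aut G` become congruences. The
automorphism β̃ is conjugation by x⁻¹ (`betaTilde_eq`), and η = α̃^a δ̃^d sends x to x^s and y to
y^w with s ≡ 1 mod N and w ≡ 1 mod p^max(r, n-r).

Case m ≤ n. Equivariance at y under β gives w ≡ s (1 + bN) mod p^m. Given this, compatibility with
the relation y x = x^(1+N) y amounts to p^r ∣ N b (b - 1). These two conditions also suffice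
(`exists_antihom_equivariant_iff`), because every automorphism has the restricted shape of
`exists_mulAut_apply`. The factor s runs through the cyclic group of units ≡ 1 mod N, which has
order p^r; hence a modulo p^r is determined by b and d, while d is free. It remains to count b
modulo p^r: since b and b - 1 are coprime, b must be 0 or 1 modulo p^(2r-m) when m - r < r, and is
arbitrary otherwise.

Case n ≤ m - r. There is now an automorphism x ↦ x y, y ↦ y, and inner automorphisms commute.
Equivariance under it forces η to be conjugation by y^(-b), so Γ must be σ ↦ conj(σ)^(-b), which is
always admissible (`exists_antihom_equivariant_iff_eq_conj`). Thus b modulo p^r is free and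
determines a and d. -/

namespace Metacyclic

/-! ### Geometric sums and units modulo prime powers. -/

section Arithmetic

theorem sum_range_mul_pow (z : ℤ) (a b : ℕ) :
    ∑ i ∈ Finset.range (a * b), z ^ i =
      (∑ i ∈ Finset.range a, z ^ i) * ∑ j ∈ Finset.range b, (z ^ a) ^ j := by
  induction b with
  | zero => simp
  | succ b ih =>
    rw [Nat.mul_succ, Finset.sum_range_add, ih, Finset.sum_range_succ, mul_add]
    congr 1
    simp_rw [pow_add, ← pow_mul]
    rw [← Finset.mul_sum, mul_comm]

theorem geom_sum_modEq_of_modEq_one {z q : ℤ} (h : z ≡ 1 [ZMOD q]) (c : ℕ) :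
    ∑ j ∈ Finset.range c, z ^ j ≡ c [ZMOD q] := by
  induction c with
  | zero => simp
  | succ c ih =>
    rw [Finset.sum_range_succ]
    push_cast
    exact ih.add (by simpa using h.pow c)

variable {p : ℕ}

theorem pow_prime_pow_modEq_one {z : ℤ} {s : ℕ} (hs : 1 ≤ s) (h : z ≡ 1 [ZMOD (p : ℤ) ^ s])
    (t : ℕ) : z ^ p ^ t ≡ 1 [ZMOD (p : ℤ) ^ (s + t)] := by
  induction t with
  | zero => simpa using h
  | succ t ih =>
    rw [pow_succ, pow_mul, ← add_assoc]
    refine (Int.modEq_iff_dvd.mpr ?_).symm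
    rw [← geom_sum_mul, pow_succ, mul_comm (Finset.sum _ _)]
    refine mul_dvd_mul ih.symm.dvd ?_
    have h1 : z ^ p ^ t ≡ 1 [ZMOD (p : ℤ)] := ih.of_dvd (dvd_pow_self _ (by omega))
    exact Int.modEq_zero_iff_dvd.mp ((geom_sum_modEq_of_modEq_one h1 p).trans (by simp [Int.ModEq]))

/-- With z = 1 + p^s c the sum is p + (p(p-1)/2) p^s c up to terms quadratic in p^s c. Oddness of p
makes (p-1)/2 an integer, so the linear term is divisible by p^(s+1). -/
theorem geom_sum_prime_modEq (hodd : Odd p) {z : ℤ} {s : ℕ} (hs : 1 ≤ s)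
    (h : z ≡ 1 [ZMOD (p : ℤ) ^ s]) :
    ∑ j ∈ Finset.range p, z ^ j ≡ p [ZMOD (p : ℤ) ^ (s + 1)] := by
  obtain ⟨c, hc⟩ := h.symm.dvd
  have hz : z = 1 + p ^ s * c := by linarith
  have hpow (j : ℕ) : z ^ j ≡ 1 + j * (p ^ s * c) [ZMOD (p : ℤ) ^ (s + 1)] := by
    induction j with
    | zero => simp
    | succ j ih =>
      rw [pow_succ z]
      refine (ih.mul_right z).trans (Int.modEq_iff_dvd.mpr ?_)
      -- The discarded term j (p^s c)² vanishes because 2s ≥ s + 1.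
      refine (pow_dvd_pow (p : ℤ) (show s + 1 ≤ s + s by omega)).trans ⟨-(j * c * c), ?_⟩
      rw [hz]
      push_cast
      ring
  have hsum (k : ℕ) : ∑ j ∈ Finset.range k, z ^ j ≡
      k + (∑ j ∈ Finset.range k, j : ℕ) * (p ^ s * c) [ZMOD (p : ℤ) ^ (s + 1)] := by
    induction k with
    | zero => simp
    | succ k ih =>
      rw [Finset.sum_range_succ, Finset.sum_range_succ]
      refine (ih.add (hpow k)).trans ?_
      push_cast
      ring_nf
      rfl
  refine (hsum p).trans ?_
  obtain ⟨l, hl⟩ := hodd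
  have hg : ∑ j ∈ Finset.range p, j = p * l := by
    have := Finset.sum_range_id_mul_two p
    have h2 : p - 1 = l * 2 := by omega
    rw [h2, ← mul_assoc] at this
    exact Nat.eq_of_mul_eq_mul_right two_pos this
  rw [hg]
  refine (Int.modEq_iff_dvd.mpr ⟨-(l * c), ?_⟩)
  push_cast
  ring

theorem geom_sum_prime_pow_modEq (hodd : Odd p) {z : ℤ} {s : ℕ} (hs : 1 ≤ s)
    (h : z ≡ 1 [ZMOD (p : ℤ) ^ s]) (t : ℕ) :
    ∑ j ∈ Finset.range (p ^ t), z ^ j ≡ (p : ℤ) ^ t [ZMOD (p : ℤ) ^ (s + t)] := by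
  induction t with
  | zero => simp
  | succ t ih =>
    rw [pow_succ, sum_range_mul_pow]
    obtain ⟨a, ha⟩ := ih.dvd
    obtain ⟨b, hb⟩ := (geom_sum_prime_modEq hodd (by omega)
      (pow_prime_pow_modEq_one hs h t)).dvd
    refine Int.modEq_iff_dvd.mpr ?_
    rw [show ∑ j ∈ Finset.range (p ^ t), z ^ j = p ^ t - p ^ (s + t) * a by linarith,
      show ∑ j ∈ Finset.range p, (z ^ p ^ t) ^ j = p - p ^ (s + t + 1) * b by linarith]
    exact ⟨a + p ^ t * b - p ^ (s + t) * a * b, by ring⟩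

/-- Modulo `p ^ (s + r)`, a geometric sum with ratio `1` modulo `p ^ s` and length divisible by
`p ^ r` equals its length. -/
theorem geom_sum_modEq_of_dvd (hodd : Odd p) {z : ℤ} {s r : ℕ} (hs : 1 ≤ s)
    (h : z ≡ 1 [ZMOD (p : ℤ) ^ s]) {t : ℕ} (ht : p ^ r ∣ t) :
    ∑ j ∈ Finset.range t, z ^ j ≡ t [ZMOD (p : ℤ) ^ (s + r)] := by
  obtain ⟨c, rfl⟩ := ht
  rw [sum_range_mul_pow]
  push_cast
  exact (geom_sum_prime_pow_modEq hodd hs h r).mul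
    (geom_sum_modEq_of_modEq_one (pow_prime_pow_modEq_one hs h r) c)

/-- Splitting off the first term leaves z times a sum of length t = w - 1; here z t ≡ t, since p^s ∣
z - 1 and p^r ∣ t. -/
theorem geom_sum_modEq_of_modEq_one_nat (hodd : Odd p) {z : ℤ} {s r : ℕ} (hs : 1 ≤ s)
    (h : z ≡ 1 [ZMOD (p : ℤ) ^ s]) {w : ℕ} (hw1 : 1 ≤ w) (hw : w ≡ 1 [MOD p ^ r]) :
    ∑ j ∈ Finset.range w, z ^ j ≡ w [ZMOD (p : ℤ) ^ (s + r)] := by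
  obtain ⟨t, rfl⟩ := Nat.exists_eq_add_of_le hw1
  have ht : p ^ r ∣ t := by
    have := (Nat.modEq_iff_dvd' hw1).mp hw.symm
    simpa using this
  rw [add_comm 1 t, Finset.sum_range_succ']
  simp_rw [pow_succ]
  rw [← Finset.sum_mul]
  have h1 := ((geom_sum_modEq_of_dvd hodd hs h ht).mul_right z).add_right (z ^ 0)
  refine h1.trans (Int.modEq_iff_dvd.mpr ?_)
  obtain ⟨c, hc⟩ := h.dvd
  obtain ⟨d, rfl⟩ := ht
  rw [show z = 1 - p ^ s * c by linarith]
  push_cast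
  exact ⟨d * c, by ring⟩

theorem orderOf_one_add_prime_pow (hp : p.Prime) (hp2 : p ≠ 2) {s m : ℕ} (hs : 1 ≤ s)
    (hsm : s ≤ m) : orderOf (1 + (p : ZMod (p ^ m)) ^ s) = p ^ (m - s) := by
  have h3 : 3 ≤ p := by have := hp.two_le; omega
  have h := ZMod.orderOf_one_add_mul_prime_pow hp s (by omega) (by nlinarith) 1
    (by
      intro h
      have := Int.le_of_dvd one_pos h
      omega) (m - s)
  rw [Nat.sub_add_cancel hsm] at h
  simpa using h

/-- `1 + p ^ s` as a unit modulo `p ^ m`. -/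
def oneAddPow (p m s : ℕ) (hs : 1 ≤ s) : (ZMod (p ^ m))ˣ :=
  ZMod.unitOfCoprime (1 + p ^ s) (by
    apply Nat.Coprime.pow_right
    obtain ⟨s, rfl⟩ := Nat.exists_eq_add_of_le' hs
    rw [pow_succ]
    simp)

theorem coe_oneAddPow {m s : ℕ} (hs : 1 ≤ s) :
    (oneAddPow p m s hs : ZMod (p ^ m)) = 1 + (p : ZMod (p ^ m)) ^ s := by
  simp [oneAddPow]

theorem orderOf_oneAddPow (hp : p.Prime) (hp2 : p ≠ 2) {s m : ℕ} (hs : 1 ≤ s)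
    (hsm : s ≤ m) : orderOf (oneAddPow p m s hs) = p ^ (m - s) := by
  rw [← orderOf_units, coe_oneAddPow, orderOf_one_add_prime_pow hp hp2 hs hsm]

theorem oneAddPow_mem_ker {s m : ℕ} (hs : 1 ≤ s) (hsm : s ≤ m) :
    oneAddPow p m s hs ∈ (ZMod.unitsMap (pow_dvd_pow p hsm)).ker := by
  rw [MonoidHom.mem_ker]
  ext
  rw [ZMod.unitsMap_val, coe_oneAddPow, ← ZMod.castHom_apply (h := pow_dvd_pow p hsm), map_add,
    map_one, map_pow, map_natCast, ← Nat.cast_pow, ZMod.natCast_self, add_zero, Units.val_one]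

theorem mem_ker_unitsMap_iff (hp : p.Prime) {s m : ℕ} (hsm : s ≤ m) (v : (ZMod (p ^ m))ˣ) :
    v ∈ (ZMod.unitsMap (pow_dvd_pow p hsm)).ker ↔
      (v : ZMod (p ^ m)).val ≡ 1 [MOD p ^ s] := by
  have : NeZero (p ^ m) := ⟨pow_ne_zero _ hp.ne_zero⟩
  rw [MonoidHom.mem_ker, ← Units.val_inj, ZMod.unitsMap_val, ← ZMod.natCast_eq_natCast_iff,
    ZMod.natCast_val]
  simp

theorem card_units_prime_pow (hp : p.Prime) {m : ℕ} (hm : 1 ≤ m) :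
    Nat.card (ZMod (p ^ m))ˣ = (p - 1) * p ^ (m - 1) := by
  have : NeZero (p ^ m) := ⟨pow_ne_zero _ hp.ne_zero⟩
  rw [Nat.card_eq_fintype_card, ZMod.card_units_eq_totient, Nat.totient_prime_pow hp (by omega),
    mul_comm]

/-- The power of a generator of the units modulo `p ^ m` that generates the units congruent to
`1` modulo `p ^ s`. -/
theorem zpowers_pow_eq_ker (hp : p.Prime) {s m : ℕ} (hs : 1 ≤ s) (hsm : s ≤ m)
    {u : (ZMod (p ^ m))ˣ} (hu : Subgroup.zpowers u = ⊤) :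
    Subgroup.zpowers (u ^ ((p - 1) * p ^ (s - 1))) =
      (ZMod.unitsMap (pow_dvd_pow p hsm)).ker := by
  have : NeZero (p ^ m) := ⟨pow_ne_zero _ hp.ne_zero⟩
  have : NeZero (p ^ s) := ⟨pow_ne_zero _ hp.ne_zero⟩
  set f := ZMod.unitsMap (pow_dvd_pow p hsm) with hf
  have hfu : Subgroup.zpowers (f u) = ⊤ := by
    rw [← MonoidHom.map_zpowers, hu, ← MonoidHom.range_eq_map, MonoidHom.range_eq_top]
    exact ZMod.unitsMap_surjective _
  -- The image of `u` generates the units modulo p^s, so u^k lies in the kernel exactly when this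
  -- order divides k.
  have hord : orderOf (f u) = (p - 1) * p ^ (s - 1) := by
    rw [← card_units_prime_pow hp hs, ← Nat.card_zpowers, hfu, Subgroup.card_top]
  apply le_antisymm
  · rw [Subgroup.zpowers_le, MonoidHom.mem_ker, map_pow, ← hord, pow_orderOf_eq_one]
  · intro v hv
    have hvu : v ∈ Subgroup.zpowers u := hu ▸ Subgroup.mem_top v
    obtain ⟨k, rfl⟩ := Subgroup.mem_zpowers_iff.mp hvu
    rw [MonoidHom.mem_ker, map_zpow, ← orderOf_dvd_iff_zpow_eq_one, hord] at hv
    obtain ⟨c, rfl⟩ := hv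
    rw [zpow_mul, zpow_natCast]
    exact Subgroup.zpow_mem_zpowers _ _

theorem orderOf_generator_pow (hp : p.Prime) {s m : ℕ} (hs : 1 ≤ s) (hsm : s ≤ m)
    {u : (ZMod (p ^ m))ˣ} (hu : Subgroup.zpowers u = ⊤) :
    orderOf (u ^ ((p - 1) * p ^ (s - 1))) = p ^ (m - s) := by
  have hp1 : 0 < p - 1 := by have := hp.two_le; omega
  have hord : orderOf u = (p - 1) * p ^ (m - 1) := by
    rw [← card_units_prime_pow hp (hs.trans hsm), ← Nat.card_zpowers, hu, Subgroup.card_top]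
  have hsplit : (p - 1) * p ^ (m - 1) = (p - 1) * p ^ (s - 1) * p ^ (m - s) := by
    rw [mul_assoc, ← pow_add]
    congr 2
    omega
  have hpos : 0 < (p - 1) * p ^ (s - 1) := Nat.mul_pos hp1 (pow_pos hp.pos _)
  rw [orderOf_pow' _ hpos.ne', hord, hsplit, Nat.gcd_eq_right (Dvd.intro _ rfl),
    Nat.mul_div_cancel_left _ hpos]

end Arithmetic

/-! ### The normal form x^k y^l. -/

section NormalForm

variable {p m n r : ℕ}

theorem y_pow_mul_x_zpow (l : ℕ) (k : ℤ) :
    y p m n r ^ l * x p m n r ^ k =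
      x p m n r ^ (k * (1 + (p : ℤ) ^ (m - r)) ^ l) * y p m n r ^ l := by
  rw [← mul_inv_eq_iff_eq_mul, ← conj_zpow, conj_pow_x, mul_comm, zpow_mul]
  congr 1

theorem x_zpow_mul_y_pow_pow (k : ℤ) (l t : ℕ) :
    (x p m n r ^ k * y p m n r ^ l) ^ t =
      x p m n r ^ (k * ∑ i ∈ Finset.range t, ((1 + (p : ℤ) ^ (m - r)) ^ l) ^ i) *
        y p m n r ^ (l * t) := by
  induction t with
  | zero => simp
  | succ t ih =>
    rw [pow_succ, ih, mul_assoc, ← mul_assoc (y p m n r ^ (l * t)), y_pow_mul_x_zpow,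
      Finset.sum_range_succ, mul_add, zpow_add, mul_add l, mul_one, pow_add, pow_mul _ l t]
    simp only [mul_assoc]

theorem x_zpow_congr {k l : ℤ} (h : k ≡ l [ZMOD (p : ℤ) ^ m]) :
    x p m n r ^ k = x p m n r ^ l := by
  rw [zpow_eq_zpow_iff_modEq]
  refine h.of_dvd ?_
  exact_mod_cast orderOf_dvd_of_pow_eq_one x_pow

theorem exists_eq_x_zpow_mul_y_pow (hp : 0 < p) (g : G p m n r) :
    ∃ (k : ℤ) (l : ℕ), g = x p m n r ^ k * y p m n r ^ l := by
  have hg : g ∈ Subgroup.closure (Set.range (PresentedGroup.of (rels := rels p m n r))) := by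
    rw [PresentedGroup.closure_range_of]
    trivial
  induction hg using Subgroup.closure_induction with
  | mem g hg =>
    obtain ⟨i, rfl⟩ := hg
    fin_cases i
    · exact ⟨1, 0, by simp [x]⟩
    · exact ⟨0, 1, by simp [y]⟩
  | one => exact ⟨0, 0, by simp⟩
  | mul g h _ _ hg hh =>
    obtain ⟨k, l, rfl⟩ := hg
    obtain ⟨k', l', rfl⟩ := hh
    refine ⟨k + k' * (1 + (p : ℤ) ^ (m - r)) ^ l, l + l', ?_⟩
    rw [mul_assoc, ← mul_assoc (y p m n r ^ l), y_pow_mul_x_zpow, zpow_add, pow_add]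
    simp only [mul_assoc]
  | inv g _ hg =>
    obtain ⟨k, l, rfl⟩ := hg
    -- The inverse is rewritten as a natural power, since the exponent of y in the normal form is a
    -- natural number.
    have hy : (y p m n r ^ l)⁻¹ = y p m n r ^ (l * (p ^ n - 1)) := by
      rw [inv_eq_iff_mul_eq_one, ← pow_add]
      have : l + l * (p ^ n - 1) = p ^ n * l := by
        obtain ⟨c, hc⟩ := Nat.exists_eq_add_of_le (Nat.one_le_pow n p hp)
        rw [hc, Nat.add_sub_cancel_left]
        ring
      rw [this, pow_mul, y_pow, one_pow]
    exact ⟨_, _, by rw [mul_inv_rev, hy, ← zpow_neg, y_pow_mul_x_zpow]⟩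

/-- The permutation `(i, j) ↦ (i + 1, j)`, by which `x` acts. -/
def permX (p m n : ℕ) : Equiv.Perm (ZMod (p ^ m) × ZMod (p ^ n)) :=
  (Equiv.addLeft 1).prodCongr (Equiv.refl _)

/-- The permutation `(i, j) ↦ (z i, j + 1)` with `z = 1 + p ^ s`, by which `y` acts. -/
def permY (p m n s : ℕ) (hs : 1 ≤ s) : Equiv.Perm (ZMod (p ^ m) × ZMod (p ^ n)) :=
  (Units.mulLeft (oneAddPow p m s hs)).prodCongr (Equiv.addLeft 1)

theorem permX_pow_apply (k : ℕ) (c : ZMod (p ^ m) × ZMod (p ^ n)) :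
    (permX p m n ^ k) c = (k + c.1, c.2) := by
  induction k with
  | zero => simp
  | succ k ih =>
    rw [pow_succ', Equiv.Perm.mul_apply, ih]
    ext
    · simp [permX]; ring
    · simp [permX]

theorem permX_zpow_apply (k : ℤ) (c : ZMod (p ^ m) × ZMod (p ^ n)) :
    (permX p m n ^ k) c = (k + c.1, c.2) := by
  obtain ⟨k, rfl | rfl⟩ := k.eq_nat_or_neg
  · simpa using permX_pow_apply k c
  · rw [zpow_neg, Equiv.Perm.inv_eq_iff_eq, zpow_natCast, permX_pow_apply]
    simp

theorem permY_pow_apply {s : ℕ} (hs : 1 ≤ s) (k : ℕ) (c : ZMod (p ^ m) × ZMod (p ^ n)) :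
    (permY p m n s hs ^ k) c = ((oneAddPow p m s hs : ZMod (p ^ m)) ^ k * c.1, k + c.2) := by
  induction k with
  | zero => simp
  | succ k ih =>
    rw [pow_succ', Equiv.Perm.mul_apply, ih]
    ext
    · simp [permY]; ring
    · simp [permY]; ring

/-- The action of `G` on `ZMod (p ^ m) × ZMod (p ^ n)` by left translation of the exponents in the
normal form. -/
def permHom (hp : p.Prime) (hp2 : p ≠ 2) (hrn : r ≤ n) (hrm : r < m) :
    G p m n r →* Equiv.Perm (ZMod (p ^ m) × ZMod (p ^ n)) :=
  lift (permX p m n) (permY p m n (m - r) (by omega))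
    (by ext c <;> rw [permX_pow_apply] <;> simp [-Nat.cast_pow])
    (by
      have h : oneAddPow p m (m - r) (by omega) ^ p ^ n = 1 := by
        rw [← orderOf_dvd_iff_pow_eq_one, orderOf_oneAddPow hp hp2 _ (by omega)]
        exact pow_dvd_pow p (by omega)
      ext c <;> rw [permY_pow_apply, ← Units.val_pow_eq_pow_val, h] <;>
        simp [-Nat.cast_pow])
    (by
      rw [mul_inv_eq_iff_eq_mul]
      ext c
      · rw [Equiv.Perm.mul_apply, Equiv.Perm.mul_apply, permX_pow_apply]
        simp [permX, permY, coe_oneAddPow]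
        ring
      · rw [Equiv.Perm.mul_apply, Equiv.Perm.mul_apply, permX_pow_apply]
        simp [permX, permY])

/-- Under the permutation action, x^k y^l carries the base point (0, 0) to (k, l), so the exponents
can be read off. -/
theorem x_zpow_mul_y_pow_eq_iff (hp : p.Prime) (hp2 : p ≠ 2) (hrn : r ≤ n) (hrm : r < m)
    {k k' : ℤ} {l l' : ℕ} :
    x p m n r ^ k * y p m n r ^ l = x p m n r ^ k' * y p m n r ^ l' ↔
      k ≡ k' [ZMOD (p : ℤ) ^ m] ∧ l ≡ l' [MOD p ^ n] := by
  constructor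
  · intro h
    have h1 := congrArg (fun g => permHom hp hp2 hrn hrm g (0, 0)) h
    simp only [map_mul, map_zpow, map_pow, permHom, lift_x, lift_y, Equiv.Perm.mul_apply,
      permX_zpow_apply, permY_pow_apply, mul_zero, add_zero, Prod.mk.injEq] at h1
    rw [ZMod.intCast_eq_intCast_iff, ZMod.natCast_eq_natCast_iff] at h1
    exact_mod_cast h1
  · rintro ⟨h, h'⟩
    rw [x_zpow_congr h, y_pow_congr h']

theorem x_zpow_eq_iff (hp : p.Prime) (hp2 : p ≠ 2) (hrn : r ≤ n) (hrm : r < m) {k k' : ℤ} :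
    x p m n r ^ k = x p m n r ^ k' ↔ k ≡ k' [ZMOD (p : ℤ) ^ m] := by
  simpa [Nat.ModEq.refl] using
    x_zpow_mul_y_pow_eq_iff hp hp2 hrn hrm (k := k) (k' := k') (l := 0) (l' := 0)

theorem mulAut_ext {φ ψ : MulAut (G p m n r)} (hx : φ (x p m n r) = ψ (x p m n r))
    (hy : φ (y p m n r) = ψ (y p m n r)) : φ = ψ :=
  MulEquiv.toMonoidHom_injective (hom_ext (f := φ.toMonoidHom) (g := ψ.toMonoidHom) hx hy)

/-- Conjugation by y^(p^r) raises x to the power (1 + p^(m-r))^(p^r) ≡ 1 mod p^m, so y^(p^r) is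
central. -/
theorem commute_y_pow (hrm : r < m) {j : ℕ} (hj : p ^ r ∣ j) (g : G p m n r) (hp : 0 < p) :
    Commute g (y p m n r ^ j) := by
  obtain ⟨c, rfl⟩ := hj
  obtain ⟨k, l, rfl⟩ := exists_eq_x_zpow_mul_y_pow hp g
  refine Commute.mul_left ?_ ((Commute.refl _).pow_pow _ _)
  have h := pow_prime_pow_modEq_one (p := p) (z := 1 + (p : ℤ) ^ (m - r)) (s := m - r)
    (by omega) (by simp [Int.ModEq]) r
  rw [Nat.sub_add_cancel hrm.le] at h
  have h' : k * (1 + (p : ℤ) ^ (m - r)) ^ (p ^ r * c) ≡ k [ZMOD (p : ℤ) ^ m] := by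
    rw [pow_mul]
    simpa using (h.pow c).mul_left k
  exact ((y_pow_mul_x_zpow _ _).trans (by rw [x_zpow_congr h'])).symm

end NormalForm

/-! ### Integer powers of an automorphism at one element. -/

section Powers

variable {H : Type*} [Group H] {h : H} {φ : MulAut H}

/-- Taking the exponent as a unit of `ZMod q` allows negative powers of φ; `ZMod.val` is harmless
because h^q = 1. -/
theorem zpow_apply_of_apply_eq_pow {q : ℕ} (hh : h ^ q = 1) {v : (ZMod q)ˣ}
    (hφ : φ h = h ^ (v : ZMod q).val) (a : ℤ) :
    (φ ^ a) h = h ^ ((v ^ a : (ZMod q)ˣ) : ZMod q).val := by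
  have key (s t : (ZMod q)ˣ) : h ^ ((s * t : (ZMod q)ˣ) : ZMod q).val =
      (h ^ (s : ZMod q).val) ^ (t : ZMod q).val := by
    rw [← pow_mul, pow_eq_pow_iff_modEq]
    refine Nat.ModEq.of_dvd (orderOf_dvd_of_pow_eq_one hh) ?_
    rw [Units.val_mul, ZMod.val_mul]
    exact Nat.mod_modEq _ _
  have h1 : h ^ ((1 : (ZMod q)ˣ) : ZMod q).val = h := by
    conv_rhs => rw [← pow_one h]
    rw [pow_eq_pow_iff_modEq]
    refine Nat.ModEq.of_dvd (orderOf_dvd_of_pow_eq_one hh) ?_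
    rw [Units.val_one, ZMod.val_one_eq_one_mod]
    exact Nat.mod_modEq _ _
  induction a with
  | zero => simpa using h1.symm
  | succ a ih =>
    rw [zpow_add_one, MulAut.mul_apply, hφ, map_pow, ih, ← key, zpow_add_one]
  | pred a ih =>
    rw [zpow_sub_one, MulAut.mul_apply, zpow_sub_one, key, ← ih, ← map_pow]
    congr 1
    rw [MulAut.inv_apply, MulEquiv.symm_apply_eq, map_pow, hφ, ← key, mul_inv_cancel, h1]

theorem zpow_apply_of_apply_eq_self (hφ : φ h = h) (a : ℤ) : (φ ^ a) h = h :=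
  (MulAction.stabilizer (MulAut H) h).zpow_mem hφ a

end Powers

/-! ### The automorphisms α̃, β̃, δ̃ on the generators. -/

section Tilde

variable {p m n r : ℕ}

/-- The factor by which `α̃` raises `x`. -/
def alphaUnit (p m r : ℕ) (u : (ZMod (p ^ m))ˣ) : (ZMod (p ^ m))ˣ :=
  u ^ ((p - 1) * p ^ (m - r - 1))

/-- The factor by which `δ̃` raises `y`. -/
def deltaUnit (p n r : ℕ) (hr : 1 ≤ r) : (ZMod (p ^ n))ˣ :=
  oneAddPow p n r hr ^ p ^ (n - 2 * r)

theorem orderOf_alphaUnit (hp : p.Prime) (hrm : r < m) {u : (ZMod (p ^ m))ˣ}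
    (hu : Subgroup.zpowers u = ⊤) : orderOf (alphaUnit p m r u) = p ^ r := by
  rw [alphaUnit, orderOf_generator_pow hp (by omega) (by omega) hu]
  congr 1
  omega

theorem alphaUnit_zpow_eq_iff (hp : p.Prime) (hrm : r < m) {u : (ZMod (p ^ m))ˣ}
    (hu : Subgroup.zpowers u = ⊤) {a a' : ℤ} :
    alphaUnit p m r u ^ a = alphaUnit p m r u ^ a' ↔ a ≡ a' [ZMOD (p : ℤ) ^ r] := by
  rw [zpow_eq_zpow_iff_modEq, orderOf_alphaUnit hp hrm hu]
  push_cast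
  rfl

theorem orderOf_deltaUnit (hp : p.Prime) (hp2 : p ≠ 2) (hr : 1 ≤ r) (hrn : r ≤ n) :
    orderOf (deltaUnit p n r hr) = p ^ min r (n - r) := by
  rw [deltaUnit, orderOf_pow' _ (pow_ne_zero _ hp.ne_zero), orderOf_oneAddPow hp hp2 hr hrn,
    Nat.gcd_eq_right (pow_dvd_pow p (by omega)), Nat.pow_div (by omega) hp.pos]
  congr 1
  omega

theorem deltaUnit_mem_ker (hr : 1 ≤ r) (hrn : r ≤ n) :
    deltaUnit p n r hr ∈ (ZMod.unitsMap (pow_dvd_pow p (show max r (n - r) ≤ n by omega))).ker := by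
  have h1 : (deltaUnit p n r hr : ZMod (p ^ n)) = (((1 + p ^ r) ^ p ^ (n - 2 * r) : ℕ)) := by
    simp [deltaUnit, coe_oneAddPow]
  have h2 := pow_pow_modEq_one (p := p) (a := 1) hr (n - 2 * r)
  -- The subtraction is truncated, so the sum is n - r for n ≥ 2r and r otherwise.
  rw [one_mul, show r + (n - 2 * r) = max r (n - r) by omega,
    ← ZMod.natCast_eq_natCast_iff] at h2
  rw [MonoidHom.mem_ker]
  ext
  rw [ZMod.unitsMap_val, h1, ZMod.cast_natCast (pow_dvd_pow p (by omega)), h2]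
  simp

theorem alphaTilde_zpow_x (u : (ZMod (p ^ m))ˣ) (a : ℤ) :
    (alphaTilde p m n r u ^ a) (x p m n r) =
      x p m n r ^ ((alphaUnit p m r u ^ a : (ZMod (p ^ m))ˣ) : ZMod (p ^ m)).val := by
  rw [alphaTilde, alphaUnit, ← zpow_natCast, ← zpow_mul, ← zpow_natCast u, ← zpow_mul]
  exact zpow_apply_of_apply_eq_pow x_pow (alpha_x u) _

theorem alphaTilde_zpow_y (u : (ZMod (p ^ m))ˣ) (a : ℤ) :
    (alphaTilde p m n r u ^ a) (y p m n r) = y p m n r := by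
  rw [alphaTilde, ← zpow_natCast, ← zpow_mul]
  exact zpow_apply_of_apply_eq_self (alpha_y u) _

theorem deltaTilde_zpow_x (hp : 0 < p) (hr : 1 ≤ r) (hrm : r < m) (d : ℤ) :
    (deltaTilde p m n r hp hr hrm ^ d) (x p m n r) = x p m n r := by
  rw [deltaTilde, ← zpow_natCast, ← zpow_mul]
  exact zpow_apply_of_apply_eq_self (delta_x hp hr hrm) _

theorem deltaTilde_zpow_y (hp : 0 < p) (hr : 1 ≤ r) (hrm : r < m) (d : ℤ) :
    (deltaTilde p m n r hp hr hrm ^ d) (y p m n r) =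
      y p m n r ^ ((deltaUnit p n r hr ^ d : (ZMod (p ^ n))ˣ) : ZMod (p ^ n)).val := by
  rw [deltaTilde, deltaUnit, ← zpow_natCast, ← zpow_mul, ← zpow_natCast (oneAddPow _ _ _ _),
    ← zpow_mul]
  refine zpow_apply_of_apply_eq_pow y_pow ?_ _
  rw [delta_y]
  apply y_pow_congr
  have : NeZero (p ^ n) := ⟨pow_ne_zero _ hp.ne'⟩
  rw [← ZMod.natCast_eq_natCast_iff, ZMod.natCast_zmod_val, coe_oneAddPow]
  simp

theorem beta_pow_y (hrm : r < m) (k : ℕ) :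
    (beta p m n r hrm ^ k) (y p m n r) = x p m n r ^ (k * p ^ (m - n)) * y p m n r := by
  induction k with
  | zero => simp
  | succ k ih =>
    have hx : (beta p m n r hrm ^ k) (x p m n r) = x p m n r := by
      rw [← zpow_natCast]
      exact zpow_apply_of_apply_eq_self (beta_x hrm) _
    rw [pow_succ, MulAut.mul_apply, beta_y, map_mul, map_pow, ih, hx, ← mul_assoc, ← pow_add]
    congr 2
    ring

theorem conj_x_zpow_y (k : ℤ) :
    x p m n r ^ k * y p m n r * (x p m n r ^ k)⁻¹ =
      x p m n r ^ (-k * (p : ℤ) ^ (m - r)) * y p m n r := by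
  have h := y_pow_mul_x_zpow (p := p) (m := m) (n := n) (r := r) 1 (-k)
  rw [pow_one, pow_one] at h
  rw [← zpow_neg, mul_assoc, h, ← mul_assoc, ← zpow_add]
  congr 2
  ring

/-- In both cases of max and min the exponents combine to p^(m-r), and x⁻¹ y x = x^(p^(m-r)) y.
Being inner, β̃ is transported by any φ through φ(x) alone. -/
theorem betaTilde_eq (hrm : r < m) (hrn : r ≤ n) :
    betaTilde p m n r hrm = (MulAut.conj (x p m n r))⁻¹ := by
  apply mulAut_ext
  · rw [← map_inv, betaTilde, ← zpow_natCast, zpow_apply_of_apply_eq_self (beta_x hrm)]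
    simp
  · have h := conj_x_zpow_y (p := p) (m := m) (n := n) (r := r) (-1)
    rw [zpow_neg_one] at h
    rw [← map_inv, MulAut.conj_apply, h, betaTilde, beta_pow_y, ← pow_add,
      show min m n - r + (m - n) = m - r by omega, neg_neg, one_mul]
    norm_cast

theorem betaTilde_zpow (hrm : r < m) (hrn : r ≤ n) (b : ℤ) :
    betaTilde p m n r hrm ^ b = MulAut.conj (x p m n r ^ (-b)) := by
  rw [betaTilde_eq hrm hrn, map_zpow, inv_zpow, zpow_neg]

theorem betaTilde_zpow_x (hrm : r < m) (hrn : r ≤ n) (b : ℤ) :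
    (betaTilde p m n r hrm ^ b) (x p m n r) = x p m n r := by
  rw [betaTilde_zpow hrm hrn, MulAut.conj_apply]
  group

theorem betaTilde_zpow_y (hrm : r < m) (hrn : r ≤ n) (b : ℤ) :
    (betaTilde p m n r hrm ^ b) (y p m n r) =
      x p m n r ^ (b * (p : ℤ) ^ (m - r)) * y p m n r := by
  rw [betaTilde_zpow hrm hrn, MulAut.conj_apply, conj_x_zpow_y, neg_neg]

theorem alphaTilde_mul_deltaTilde_x (hp : 0 < p) (hr : 1 ≤ r) (hrm : r < m)
    (u : (ZMod (p ^ m))ˣ) (a d : ℤ) :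
    (alphaTilde p m n r u ^ a * deltaTilde p m n r hp hr hrm ^ d) (x p m n r) =
      x p m n r ^ ((alphaUnit p m r u ^ a : (ZMod (p ^ m))ˣ) : ZMod (p ^ m)).val := by
  rw [MulAut.mul_apply, deltaTilde_zpow_x, alphaTilde_zpow_x]

theorem alphaTilde_mul_deltaTilde_y (hp : 0 < p) (hr : 1 ≤ r) (hrm : r < m)
    (u : (ZMod (p ^ m))ˣ) (a d : ℤ) :
    (alphaTilde p m n r u ^ a * deltaTilde p m n r hp hr hrm ^ d) (y p m n r) =
      y p m n r ^ ((deltaUnit p n r hr ^ d : (ZMod (p ^ n))ˣ) : ZMod (p ^ n)).val := by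
  rw [MulAut.mul_apply, deltaTilde_zpow_y, map_pow, alphaTilde_zpow_y]

theorem alphaUnit_zpow_val_modEq_one (hp : p.Prime) (hrm : r < m) {u : (ZMod (p ^ m))ˣ}
    (hu : Subgroup.zpowers u = ⊤) (a : ℤ) :
    ((alphaUnit p m r u ^ a : (ZMod (p ^ m))ˣ) : ZMod (p ^ m)).val ≡ 1 [MOD p ^ (m - r)] := by
  rw [← mem_ker_unitsMap_iff hp (by omega), ← zpowers_pow_eq_ker hp (by omega) (by omega) hu]
  exact Subgroup.zpow_mem_zpowers _ _

theorem deltaUnit_zpow_val_modEq_one (hp : p.Prime) (hr : 1 ≤ r) (hrn : r ≤ n) (d : ℤ) :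
    ((deltaUnit p n r hr ^ d : (ZMod (p ^ n))ˣ) : ZMod (p ^ n)).val ≡ 1
      [MOD p ^ max r (n - r)] := by
  rw [← mem_ker_unitsMap_iff hp (by omega)]
  exact Subgroup.zpow_mem _ (deltaUnit_mem_ker hr hrn) d

end Tilde

/-! ### Antihomomorphisms. -/

section Antihom

variable {H : Type*} [Group H] {Γ : H → MulAut H}

/-- An antihomomorphism as a homomorphism into the opposite group. -/
def IsAntihom.toHom (h : IsAntihom Γ) : H →* (MulAut H)ᵐᵒᵖ :=
  MonoidHom.mk' (fun g => MulOpposite.op (Γ g)) fun a b => by rw [h a b, MulOpposite.op_mul]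

theorem IsAntihom.map_pow (h : IsAntihom Γ) (g : H) (k : ℕ) : Γ (g ^ k) = Γ g ^ k :=
  congrArg MulOpposite.unop (_root_.map_pow h.toHom g k)

theorem IsAntihom.map_zpow (h : IsAntihom Γ) (g : H) (k : ℤ) : Γ (g ^ k) = Γ g ^ k :=
  congrArg MulOpposite.unop (_root_.map_zpow h.toHom g k)

theorem isAntihom_unop (f : H →* (MulAut H)ᵐᵒᵖ) : IsAntihom fun g => (f g).unop := by
  intro a b
  beta_reduce
  rw [_root_.map_mul, MulOpposite.unop_mul]

end Antihom

/-! ### Congruence and power rules used in the case analysis. -/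

variable {p m n r : ℕ}

theorem coe_oneAddPow_eq_intCast {s : ℕ} (hs : 1 ≤ s) :
    (oneAddPow p m s hs : ZMod (p ^ m)) = ((1 + (p : ℤ) ^ s : ℤ) : ZMod (p ^ m)) := by
  rw [coe_oneAddPow]
  push_cast
  rfl

theorem one_add_pow_modEq_iff (hp : p.Prime) (hp2 : p ≠ 2) (hrm : r < m) {l l' : ℕ} :
    (1 + (p : ℤ) ^ (m - r)) ^ l ≡ (1 + (p : ℤ) ^ (m - r)) ^ l' [ZMOD (p : ℤ) ^ m] ↔
      l ≡ l' [MOD p ^ r] := by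
  have h1 := orderOf_oneAddPow hp hp2 (s := m - r) (m := m) (by omega) (by omega)
  rw [show m - (m - r) = r by omega] at h1
  rw [← h1, ← pow_eq_pow_iff_modEq, ← Units.val_inj, Units.val_pow_eq_pow_val,
    Units.val_pow_eq_pow_val, coe_oneAddPow_eq_intCast, ← Int.cast_pow, ← Int.cast_pow,
    ZMod.intCast_eq_intCast_iff]
  push_cast
  rfl

theorem one_add_pow_pow_modEq_one {s : ℕ} (l : ℕ) :
    (1 + (p : ℤ) ^ s) ^ l ≡ 1 [ZMOD (p : ℤ) ^ s] := by
  have : 1 + (p : ℤ) ^ s ≡ 1 [ZMOD (p : ℤ) ^ s] := by simp [Int.ModEq]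
  simpa using this.pow l

theorem one_le_of_modEq_one (hp : p.Prime) (hr : 1 ≤ r) {w : ℕ} (hw : w ≡ 1 [MOD p ^ r]) :
    1 ≤ w := by
  rcases Nat.eq_zero_or_pos w with rfl | h
  · have := (Nat.modEq_zero_iff_dvd.mp hw.symm)
    rw [Nat.dvd_one] at this
    exact absurd this (Nat.one_lt_pow (by omega) hp.one_lt).ne'
  · exact h

/-- The exponent of x is k times a geometric sum of length w with ratio ≡ 1 mod p^(m-r), and that
sum is w modulo p^m. -/
theorem x_zpow_mul_y_pow_pow_of_modEq (hp : p.Prime) (hp2 : p ≠ 2) (hr : 1 ≤ r) (hrm : r < m)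
    (k : ℤ) (l : ℕ) {w : ℕ} (hw : w ≡ 1 [MOD p ^ r]) :
    (x p m n r ^ k * y p m n r ^ l) ^ w = x p m n r ^ (k * w) * y p m n r ^ (l * w) := by
  rw [x_zpow_mul_y_pow_pow]
  congr 1
  apply x_zpow_congr
  have h := geom_sum_modEq_of_modEq_one_nat (hp.odd_of_ne_two hp2) (s := m - r) (by omega)
    (one_add_pow_pow_modEq_one (p := p) l) (one_le_of_modEq_one hp hr hw) hw
  rw [Nat.sub_add_cancel hrm.le] at h
  exact h.mul_left k

theorem pow_mul_modEq_of_modEq_one (hrm : r < m) {w : ℕ} (hw : w ≡ 1 [MOD p ^ r]) :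
    (p : ℤ) ^ (m - r) * w ≡ (p : ℤ) ^ (m - r) [ZMOD (p : ℤ) ^ m] := by
  have h1 : (w : ℤ) ≡ 1 [ZMOD (p : ℤ) ^ r] := by exact_mod_cast Int.natCast_modEq_iff.mpr hw
  have h2 := h1.mul_left' (c := (p : ℤ) ^ (m - r))
  rwa [← pow_add, Nat.sub_add_cancel hrm.le, mul_one] at h2

theorem betaTilde_zpow_x_zpow_mul_y_pow (hp : p.Prime) (hp2 : p ≠ 2) (hr : 1 ≤ r) (hrn : r ≤ n)
    (hrm : r < m) (b k : ℤ) {w : ℕ} (hw : w ≡ 1 [MOD p ^ r]) :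
    (betaTilde p m n r hrm ^ b) (x p m n r ^ k * y p m n r ^ w) =
      x p m n r ^ (k + b * (p : ℤ) ^ (m - r)) * y p m n r ^ w := by
  have h := x_zpow_mul_y_pow_pow_of_modEq (n := n) hp hp2 hr hrm (b * (p : ℤ) ^ (m - r)) 1 hw
  rw [pow_one, one_mul] at h
  rw [map_mul, map_zpow, map_pow, betaTilde_zpow_x hrm hrn, betaTilde_zpow_y hrm hrn, h,
    ← mul_assoc, ← zpow_add]
  congr 1
  apply x_zpow_congr
  rw [mul_assoc]
  exact ((pow_mul_modEq_of_modEq_one hrm hw).mul_left b).add_left k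

/-- For fixed φ both sides are antimultiplicative in σ. -/
theorem isEquivariant_of_generators (hp : 0 < p) {Γ : G p m n r → MulAut (G p m n r)}
    (hΓ : IsAntihom Γ)
    (hx : ∀ φ : MulAut (G p m n r), Γ (φ (x p m n r)) = φ * Γ (x p m n r) * φ⁻¹)
    (hy : ∀ φ : MulAut (G p m n r), Γ (φ (y p m n r)) = φ * Γ (y p m n r) * φ⁻¹) :
    IsEquivariant Γ := by
  intro φ σ
  obtain ⟨k, l, rfl⟩ := exists_eq_x_zpow_mul_y_pow hp σ
  rw [map_mul, map_zpow, map_pow, hΓ, hΓ, hΓ.map_zpow, hΓ.map_zpow, hΓ.map_pow, hΓ.map_pow, hx, hy,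
    conj_zpow, conj_pow]
  group

theorem mulAut_mul_conj_mul_inv {H : Type*} [Group H] (φ : MulAut H) (g : H) :
    φ * MulAut.conj g * φ⁻¹ = MulAut.conj (φ g) := by
  ext h
  simp

/-! ### The case m ≤ n. -/

section LargeN

/-- The shape of the automorphisms of `G` for `m ≤ n`. -/
theorem exists_mulAut_apply (hp : p.Prime) (hp2 : p ≠ 2) (hr : 1 ≤ r) (hrn : r ≤ n)
    (hrm : r < m) (hmn : m ≤ n) (φ : MulAut (G p m n r)) :
    ∃ (i : ℤ) (j : ℕ) (k : ℤ) (l : ℕ), φ (x p m n r) = x p m n r ^ i * y p m n r ^ j ∧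
      φ (y p m n r) = x p m n r ^ k * y p m n r ^ l ∧
      p ^ (n - (m - r)) ∣ j ∧ l ≡ 1 [MOD p ^ r] := by
  obtain ⟨i, j, hx⟩ := exists_eq_x_zpow_mul_y_pow hp.pos (φ (x p m n r))
  obtain ⟨k, l, hy⟩ := exists_eq_x_zpow_mul_y_pow hp.pos (φ (y p m n r))
  refine ⟨i, j, k, l, hx, hy, ?_⟩
  -- The constraints come from comparing normal forms in the image of y x = x^(1+N) y, where N =
  -- p^(m-r).
  have hrel : φ (y p m n r) * φ (x p m n r) = φ (x p m n r) ^ (1 + p ^ (m - r)) * φ (y p m n r) := by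
    rw [← map_mul, ← map_pow, ← map_mul, ← mul_inv_eq_iff_eq_mul.mp (conj_x (p := p) (m := m))]
  have e1 : φ (y p m n r) * φ (x p m n r) =
      x p m n r ^ (k + i * (1 + (p : ℤ) ^ (m - r)) ^ l) * y p m n r ^ (l + j) := by
    rw [hx, hy, mul_assoc, ← mul_assoc (y p m n r ^ l), y_pow_mul_x_zpow, zpow_add, pow_add]
    simp only [mul_assoc]
  have e2 : φ (x p m n r) ^ (1 + p ^ (m - r)) * φ (y p m n r) =
      x p m n r ^ (i * ∑ t ∈ Finset.range (1 + p ^ (m - r)), ((1 + (p : ℤ) ^ (m - r)) ^ j) ^ t +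
        k * (1 + (p : ℤ) ^ (m - r)) ^ (j * (1 + p ^ (m - r)))) *
      y p m n r ^ (j * (1 + p ^ (m - r)) + l) := by
    rw [hx, hy, x_zpow_mul_y_pow_pow, mul_assoc, ← mul_assoc (y p m n r ^ _), y_pow_mul_x_zpow,
      zpow_add, pow_add]
    simp only [mul_assoc]
  rw [e1, e2, x_zpow_mul_y_pow_eq_iff hp hp2 hrn hrm] at hrel
  obtain ⟨h1, h2⟩ := hrel
  -- The exponents of y give j N ≡ 0 mod p^n.
  have hj : p ^ (n - (m - r)) ∣ j := by
    have h3 : l + j + 0 ≡ l + j + j * p ^ (m - r) [MOD p ^ n] := by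
      convert! h2 using 1
      ring
    have h4 := (Nat.modEq_zero_iff_dvd).mp (Nat.ModEq.add_left_cancel' _ h3).symm
    rw [show n = (n - (m - r)) + (m - r) by omega, pow_add] at h4
    have h5 := Nat.dvd_of_mul_dvd_mul_right (pow_pos hp.pos _) h4
    convert! h5 using 2
  have hrj : p ^ r ∣ j := (pow_dvd_pow p (by omega)).trans hj
  refine ⟨hj, ?_⟩
  have hzj : (1 + (p : ℤ) ^ (m - r)) ^ j ≡ 1 [ZMOD (p : ℤ) ^ m] := by
    simpa using (one_add_pow_modEq_iff hp hp2 hrm (l := j) (l' := 0)).mpr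
      (Nat.modEq_zero_iff_dvd.mpr hrj)
  -- Since p^r ∣ j, the ratio (1 + N)^j is 1 modulo p^m, and the exponents of x reduce to this.
  have h6 : k + i * (1 + (p : ℤ) ^ (m - r)) ^ l ≡ k + i * (1 + (p : ℤ) ^ (m - r))
      [ZMOD (p : ℤ) ^ m] := by
    refine h1.trans ?_
    rw [add_comm]
    refine Int.ModEq.add ?_ ?_
    · rw [pow_mul]
      simpa using (hzj.pow (1 + p ^ (m - r))).mul_left k
    · exact_mod_cast (geom_sum_modEq_of_modEq_one hzj (1 + p ^ (m - r))).mul_left i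
  -- Otherwise φ(x), and hence x, would have order dividing p^(m-1). So i can be cancelled.
  have hi : ¬ (p : ℤ) ∣ i := by
    rintro ⟨c, rfl⟩
    have h7 : φ (x p m n r) ^ p ^ (m - 1) = 1 := by
      rw [hx, (commute_y_pow hrm hrj _ hp.pos).mul_pow, ← pow_mul, ← zpow_natCast, ← zpow_mul]
      have h8 : x p m n r ^ ((p : ℤ) * c * ((p ^ (m - 1) : ℕ) : ℤ)) = x p m n r ^ (0 : ℤ) := by
        apply x_zpow_congr
        refine Int.modEq_zero_iff_dvd.mpr ⟨c, ?_⟩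
        rw [show (p : ℤ) ^ m = p ^ (m - 1) * p by rw [← pow_succ]; congr 1; omega]
        push_cast
        ring
      have h9 : y p m n r ^ (j * p ^ (m - 1)) = y p m n r ^ 0 := by
        apply y_pow_congr
        refine Nat.modEq_zero_iff_dvd.mpr ?_
        refine (pow_dvd_pow p (show n ≤ (n - (m - r)) + (m - 1) by omega)).trans ?_
        rw [pow_add]
        exact mul_dvd_mul_right hj _
      rw [h8, h9]
      simp
    rw [← map_pow, map_eq_one_iff φ φ.injective, ← zpow_natCast, ← zpow_zero (x p m n r),
      x_zpow_eq_iff hp hp2 hrn hrm, Int.modEq_zero_iff_dvd] at h7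
    have h10 : p ^ m ∣ p ^ (m - 1) := by exact_mod_cast h7
    have := (Nat.pow_dvd_pow_iff_le_right hp.one_lt).mp h10
    omega
  have h11 := Int.ModEq.add_left_cancel' _ h6
  have hcop : IsCoprime ((p : ℤ) ^ m) i :=
    IsCoprime.pow_left ((Nat.prime_iff_prime_int.mp hp).coprime_iff_not_dvd.mpr hi)
  have h12 : (1 + (p : ℤ) ^ (m - r)) ^ l ≡ (1 + (p : ℤ) ^ (m - r)) ^ 1 [ZMOD (p : ℤ) ^ m] := by
    rw [pow_one]
    refine Int.modEq_iff_dvd.mpr (hcop.dvd_of_dvd_mul_left ?_)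
    rw [mul_sub]
    exact h11.dvd
  exact (one_add_pow_modEq_iff hp hp2 hrm).mp h12

theorem beta_y_of_le (hrm : r < m) (hmn : m ≤ n) :
    beta p m n r hrm (y p m n r) = x p m n r * y p m n r := by
  rw [beta_y, Nat.sub_eq_zero_of_le hmn, pow_zero, pow_one]

variable {η : MulAut (G p m n r)} {s w : ℕ} {b : ℤ}

/-- For an antihomomorphism Γ with these values, Γ(β y) = Γ(x y) = η β̃^b, so the hypothesis is
equivariance at y under β. At y the two sides of η β̃^b β = β η are x^(s(1+bN)) y^w and (x y)^w =
x^w y^w, where N = p^(m-r). -/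
theorem modEq_of_beta_equivariant (hp : p.Prime) (hp2 : p ≠ 2) (hr : 1 ≤ r) (hrn : r ≤ n)
    (hrm : r < m) (hmn : m ≤ n) (hηx : η (x p m n r) = x p m n r ^ s)
    (hηy : η (y p m n r) = y p m n r ^ w) (hw : w ≡ 1 [MOD p ^ r])
    (h : η * betaTilde p m n r hrm ^ b = beta p m n r hrm * η * (beta p m n r hrm)⁻¹) :
    (w : ℤ) ≡ s * (1 + b * (p : ℤ) ^ (m - r)) [ZMOD (p : ℤ) ^ m] := by
  rw [eq_mul_inv_iff_mul_eq] at h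
  have h1 := DFunLike.congr_fun h (y p m n r)
  have h2 := x_zpow_mul_y_pow_pow_of_modEq (n := n) hp hp2 hr hrm 1 1 hw
  have h3 := betaTilde_zpow_x_zpow_mul_y_pow hp hp2 hr hrn hrm b 1 (Nat.ModEq.refl 1)
  simp only [zpow_one, pow_one, one_mul] at h2 h3
  rw [MulAut.mul_apply, MulAut.mul_apply, MulAut.mul_apply, hηy, map_pow,
    beta_y_of_le hrm hmn, h2, h3, map_mul, map_zpow, hηx, hηy, ← zpow_natCast, ← zpow_mul,
    x_zpow_mul_y_pow_eq_iff hp hp2 hrn hrm] at h1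
  exact h1.1.symm

/-- The operator identity is what an antihomomorphism makes of y x = x^(1+N) y, N = p^(m-r). Both
sides send x to x^s, so only their values at y matter. -/
theorem betaTilde_mul_eq_iff (hp : p.Prime) (hp2 : p ≠ 2) (hr : 1 ≤ r) (hrn : r ≤ n)
    (hrm : r < m) (hηx : η (x p m n r) = x p m n r ^ s)
    (hηy : η (y p m n r) = y p m n r ^ w) (hw : w ≡ 1 [MOD p ^ r]) :
    betaTilde p m n r hrm ^ b * η =
        η * (betaTilde p m n r hrm ^ b) ^ (1 + p ^ (m - r)) ↔
      b * (p : ℤ) ^ (m - r) ≡ s * (b * (1 + (p : ℤ) ^ (m - r)) * (p : ℤ) ^ (m - r))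
        [ZMOD (p : ℤ) ^ m] := by
  have e1 : (betaTilde p m n r hrm ^ b) ^ (1 + p ^ (m - r)) =
      betaTilde p m n r hrm ^ (b * (1 + (p : ℤ) ^ (m - r))) := by
    rw [← zpow_natCast, ← zpow_mul]
    push_cast
    rfl
  have h2 := betaTilde_zpow_x_zpow_mul_y_pow hp hp2 hr hrn hrm b 0 hw
  rw [zpow_zero, one_mul, zero_add] at h2
  have e2 : (betaTilde p m n r hrm ^ b * η) (y p m n r) =
      x p m n r ^ (b * (p : ℤ) ^ (m - r)) * y p m n r ^ w := by
    rw [MulAut.mul_apply, hηy, h2]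
  have e3 : (η * betaTilde p m n r hrm ^ (b * (1 + (p : ℤ) ^ (m - r)))) (y p m n r) =
      x p m n r ^ (s * (b * (1 + (p : ℤ) ^ (m - r)) * (p : ℤ) ^ (m - r))) * y p m n r ^ w := by
    rw [MulAut.mul_apply, betaTilde_zpow_y hrm hrn, map_mul, map_zpow, hηx, hηy,
      ← zpow_natCast, ← zpow_mul]
  rw [e1]
  constructor
  · intro h
    have h1 := DFunLike.congr_fun h (y p m n r)
    rw [e2, e3, x_zpow_mul_y_pow_eq_iff hp hp2 hrn hrm] at h1
    exact h1.1
  · intro h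
    apply mulAut_ext
    · rw [MulAut.mul_apply, MulAut.mul_apply, betaTilde_zpow_x hrm hrn, hηx, map_pow,
        betaTilde_zpow_x hrm hrn]
    · rw [e2, e3, x_zpow_congr h]

/-- Let N = p^(m-r). As w N ≡ N mod p^m, the hypothesis lets N on the left be replaced by s (1 + bN)
N. The difference of the two sides is then s N² b (b - 1), and s is prime to p. -/
theorem relation_modEq_iff (hp : p.Prime) (hrm : r < m)
    (hs : s ≡ 1 [MOD p ^ (m - r)]) (hw : w ≡ 1 [MOD p ^ r])
    (h : (w : ℤ) ≡ s * (1 + b * (p : ℤ) ^ (m - r)) [ZMOD (p : ℤ) ^ m]) :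
    b * (p : ℤ) ^ (m - r) ≡ s * (b * (1 + (p : ℤ) ^ (m - r)) * (p : ℤ) ^ (m - r))
        [ZMOD (p : ℤ) ^ m] ↔
      (p : ℤ) ^ r ∣ (p : ℤ) ^ (m - r) * (b * (b - 1)) := by
  have hs' : (s : ℤ) ≡ 1 [ZMOD p] := by
    have h1 := Int.natCast_modEq_iff.mpr (hs.of_dvd (dvd_pow_self p (by omega)))
    exact_mod_cast h1
  have hcop : IsCoprime ((p : ℤ) ^ r) s := by
    refine IsCoprime.pow_left ((Nat.prime_iff_prime_int.mp hp).coprime_iff_not_dvd.mpr ?_)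
    intro hd
    have h1 := (Int.modEq_zero_iff_dvd.mpr hd).symm.trans hs'
    exact (Nat.prime_iff_prime_int.mp hp).not_dvd_one (by simpa using h1.dvd)
  have hwN : (w : ℤ) * (p : ℤ) ^ (m - r) ≡ (p : ℤ) ^ (m - r) [ZMOD (p : ℤ) ^ m] := by
    rw [mul_comm]
    exact pow_mul_modEq_of_modEq_one hrm hw
  have hN := ((h.mul_right ((p : ℤ) ^ (m - r))).symm.trans hwN).mul_left b
  have hpm : (p : ℤ) ^ m = p ^ (m - r) * p ^ r := by rw [← pow_add]; congr 1; omega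
  have hp0 : (p : ℤ) ^ (m - r) ≠ 0 := pow_ne_zero _ (by exact_mod_cast hp.ne_zero)
  calc _ ↔ b * (s * (1 + b * (p : ℤ) ^ (m - r)) * p ^ (m - r)) ≡
        s * (b * (1 + (p : ℤ) ^ (m - r)) * (p : ℤ) ^ (m - r)) [ZMOD (p : ℤ) ^ m] :=
        ⟨hN.trans, hN.symm.trans⟩
    _ ↔ (p : ℤ) ^ (m - r) * p ^ r ∣ p ^ (m - r) * (s * (p ^ (m - r) * (b * (b - 1)))) := by
        rw [Int.modEq_comm, Int.modEq_iff_dvd, hpm]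
        ring_nf
    _ ↔ (p : ℤ) ^ r ∣ s * (p ^ (m - r) * (b * (b - 1))) := mul_dvd_mul_iff_left hp0
    _ ↔ _ := ⟨hcop.dvd_of_dvd_mul_left, fun h => h.mul_left _⟩

theorem conj_y_pow_eq_one (hp : 0 < p) (hrm : r < m) {j : ℕ} (hj : p ^ r ∣ j) :
    MulAut.conj (y p m n r ^ j) = 1 := by
  ext g
  rw [MulAut.conj_apply, ← (commute_y_pow hrm hj g hp).eq]
  simp

/-- Both sides are conjugation by x^(-bi): η^j is trivial, and y^j is central, so it drops out of
conjugation by φ(x). -/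
theorem equivariant_x_of_pow_eq_one (hp : p.Prime) (hrn : r ≤ n) (hrm : r < m)
    (hη : η ^ p ^ r = 1) (φ : MulAut (G p m n r)) {i : ℤ} {j : ℕ}
    (hφ : φ (x p m n r) = x p m n r ^ i * y p m n r ^ j) (hj : p ^ r ∣ j) :
    η ^ j * (betaTilde p m n r hrm ^ b) ^ i = φ * betaTilde p m n r hrm ^ b * φ⁻¹ := by
  rw [betaTilde_zpow hrm hrn, mulAut_mul_conj_mul_inv, map_zpow φ, hφ, map_zpow MulAut.conj,
    map_zpow MulAut.conj, map_mul, conj_y_pow_eq_one hp.pos hrm hj, mul_one,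
    orderOf_dvd_iff_pow_eq_one.mp ((orderOf_dvd_of_pow_eq_one hη).trans hj), one_mul,
    map_zpow, ← zpow_mul, ← zpow_mul, mul_comm]

theorem equivariant_y_of_modEq (hp : p.Prime) (hp2 : p ≠ 2) (hr : 1 ≤ r) (hrn : r ≤ n)
    (hrm : r < m) (hmn : m ≤ n) (hηx : η (x p m n r) = x p m n r ^ s)
    (hηy : η (y p m n r) = y p m n r ^ w) (hs : s ≡ 1 [MOD p ^ (m - r)])
    (hw : w ≡ 1 [MOD p ^ max r (n - r)])
    (h : (w : ℤ) ≡ s * (1 + b * (p : ℤ) ^ (m - r)) [ZMOD (p : ℤ) ^ m])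
    (φ : MulAut (G p m n r)) {i k : ℤ} {j l : ℕ}
    (hφx : φ (x p m n r) = x p m n r ^ i * y p m n r ^ j)
    (hφy : φ (y p m n r) = x p m n r ^ k * y p m n r ^ l)
    (hj : p ^ (n - (m - r)) ∣ j) (hl : l ≡ 1 [MOD p ^ r]) :
    η * (betaTilde p m n r hrm ^ b) ^ k = φ * η * φ⁻¹ := by
  have hrj : p ^ r ∣ j := (pow_dvd_pow p (by omega)).trans hj
  have hwr : w ≡ 1 [MOD p ^ r] := hw.of_dvd (pow_dvd_pow p (by omega))
  have hwm : w ≡ 1 [MOD p ^ (m - r)] := hw.of_dvd (pow_dvd_pow p (by omega))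
  rw [eq_mul_inv_iff_mul_eq, ← zpow_mul]
  apply mulAut_ext
  · have hb : (betaTilde p m n r hrm ^ (b * k)) (y p m n r ^ j) = y p m n r ^ j := by
      rw [betaTilde_zpow hrm hrn, MulAut.conj_apply, (commute_y_pow hrm hrj _ hp.pos).eq]
      group
    rw [MulAut.mul_apply, MulAut.mul_apply, MulAut.mul_apply, hφx, map_mul, map_zpow, hb,
      betaTilde_zpow_x hrm hrn, map_mul, map_zpow, map_pow, hηx, hηy, map_pow, hφx,
      (commute_y_pow hrm hrj _ hp.pos).mul_pow, ← zpow_natCast _ s, ← zpow_natCast _ s,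
      ← zpow_mul, ← zpow_mul, ← pow_mul, ← pow_mul, mul_comm (s : ℤ)]
    congr 1
    apply y_pow_congr
    -- The exponents s j and w j of y agree modulo p^n because s ≡ w mod p^(m-r) and p^(n-(m-r)) ∣
    -- j.
    obtain ⟨c, rfl⟩ := hj
    have h1 := ((hwm.trans hs.symm).mul_right' (c := p ^ (n - (m - r)))).mul_right c
    rw [← pow_add, show m - r + (n - (m - r)) = n by omega] at h1
    convert! h1 using 1 <;> ring
  · rw [MulAut.mul_apply, MulAut.mul_apply, MulAut.mul_apply, hφy,
      betaTilde_zpow_x_zpow_mul_y_pow hp hp2 hr hrn hrm _ _ hl, map_mul, map_zpow, map_pow, hηx,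
      hηy, map_pow, hφy, x_zpow_mul_y_pow_pow_of_modEq hp hp2 hr hrm k l hwr, ← zpow_natCast,
      ← zpow_mul, ← pow_mul, mul_comm l]
    congr 1
    apply x_zpow_congr
    -- The required congruence is k times the one given by β alone.
    refine Int.ModEq.symm ?_
    convert! h.mul_left k using 1
    ring

/-- Necessity uses only the automorphism β and the defining relation. Sufficiency extends the
assignment by the presentation, with values in the opposite group, and checks equivariance at x and
y against the general shape of an automorphism. -/
theorem exists_antihom_equivariant_iff (hp : p.Prime) (hp2 : p ≠ 2) (hr : 1 ≤ r) (hrn : r ≤ n)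
    (hrm : r < m) (hmn : m ≤ n) (hηx : η (x p m n r) = x p m n r ^ s)
    (hηy : η (y p m n r) = y p m n r ^ w) (hs : s ≡ 1 [MOD p ^ (m - r)])
    (hw : w ≡ 1 [MOD p ^ max r (n - r)]) (hη : η ^ p ^ r = 1) :
    (∃ Γ : G p m n r → MulAut (G p m n r), IsAntihom Γ ∧
      Γ (x p m n r) = betaTilde p m n r hrm ^ b ∧ Γ (y p m n r) = η ∧ IsEquivariant Γ) ↔
      (w : ℤ) ≡ s * (1 + b * (p : ℤ) ^ (m - r)) [ZMOD (p : ℤ) ^ m] ∧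
        (p : ℤ) ^ r ∣ (p : ℤ) ^ (m - r) * (b * (b - 1)) := by
  have hwr : w ≡ 1 [MOD p ^ r] := hw.of_dvd (pow_dvd_pow p (by omega))
  constructor
  · rintro ⟨Γ, hΓ, hx, hy, heq⟩
    have h1 : (w : ℤ) ≡ s * (1 + b * (p : ℤ) ^ (m - r)) [ZMOD (p : ℤ) ^ m] := by
      apply modEq_of_beta_equivariant hp hp2 hr hrn hrm hmn hηx hηy hwr
      rw [← hx, ← hy, ← hΓ, ← heq, beta_y_of_le hrm hmn]
    refine ⟨h1, (relation_modEq_iff hp hrm hs hwr h1).mp ?_⟩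
    rw [← betaTilde_mul_eq_iff hp hp2 hr hrn hrm hηx hηy hwr, ← hx, ← hy, ← hΓ, ← hΓ.map_pow, ← hΓ,
      ← mul_inv_eq_iff_eq_mul.mp (conj_x (p := p) (m := m))]
  · rintro ⟨h1, h2⟩
    have h3 := (betaTilde_mul_eq_iff hp hp2 hr hrn hrm hηx hηy hwr).mpr
      ((relation_modEq_iff hp hrm hs hwr h1).mpr h2)
    have hB : (betaTilde p m n r hrm ^ b) ^ p ^ m = 1 := by
      rw [betaTilde_zpow hrm hrn, ← map_pow, ← zpow_natCast, ← zpow_mul, mul_comm, zpow_mul,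
        zpow_natCast, x_pow, one_zpow, map_one]
    have hη' : η ^ p ^ n = 1 := orderOf_dvd_iff_pow_eq_one.mp
      ((orderOf_dvd_of_pow_eq_one hη).trans (pow_dvd_pow p hrn))
    obtain ⟨Γ, hΓ, hΓx, hΓy⟩ : ∃ Γ : G p m n r → MulAut (G p m n r), IsAntihom Γ ∧
        Γ (x p m n r) = betaTilde p m n r hrm ^ b ∧ Γ (y p m n r) = η := by
      refine ⟨_, isAntihom_unop (lift (MulOpposite.op (betaTilde p m n r hrm ^ b))
        (MulOpposite.op η) ?_ ?_ ?_), ?_, ?_⟩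
      · rw [← MulOpposite.op_pow, hB, MulOpposite.op_one]
      · rw [← MulOpposite.op_pow, hη', MulOpposite.op_one]
      · rw [mul_inv_eq_iff_eq_mul, ← MulOpposite.op_mul, ← MulOpposite.op_pow,
          ← MulOpposite.op_mul, h3]
      · rw [lift_x, MulOpposite.unop_op]
      · rw [lift_y, MulOpposite.unop_op]
    refine ⟨Γ, hΓ, hΓx, hΓy, isEquivariant_of_generators hp.pos hΓ ?_ ?_⟩
    · intro φ
      obtain ⟨i, j, k, l, hφx, hφy, hj, hl⟩ := exists_mulAut_apply hp hp2 hr hrn hrm hmn φ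
      have := equivariant_x_of_pow_eq_one (b := b) hp hrn hrm hη φ hφx
        ((pow_dvd_pow p (by omega)).trans hj)
      rw [hφx, hΓ, hΓ.map_zpow, hΓ.map_pow, hΓx, hΓy, this]
    · intro φ
      obtain ⟨i, j, k, l, hφx, hφy, hj, hl⟩ := exists_mulAut_apply hp hp2 hr hrn hrm hmn φ
      have := equivariant_y_of_modEq (b := b) hp hp2 hr hrn hrm hmn hηx hηy hs hw h1 φ hφx hφy hj hl
      -- Γ(φ y) is η^l times a power of β̃^b; the exponent l ≡ 1 mod p^r disappears because η^(p^r)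
      -- = 1.
      have hηl : η ^ l = η := by
        conv_rhs => rw [← pow_one η]
        rw [pow_eq_pow_iff_modEq]
        exact hl.of_dvd (orderOf_dvd_of_pow_eq_one hη)
      rw [hφy, hΓ, hΓ.map_zpow, hΓ.map_pow, hΓx, hΓy, hηl, this]

theorem admissible_iff_of_le (hp : p.Prime) (hp2 : p ≠ 2) (hr : 1 ≤ r) (hrn : r ≤ n)
    (hrm : r < m) (hmn : m ≤ n) {u : (ZMod (p ^ m))ˣ} (hu : Subgroup.zpowers u = ⊤)
    (a b d : ℤ) :
    Admissible p m n r hp.pos hr hrm u (a, b, d) ↔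
      (((deltaUnit p n r hr ^ d : (ZMod (p ^ n))ˣ) : ZMod (p ^ n)).val : ℤ) ≡
          ((alphaUnit p m r u ^ a : (ZMod (p ^ m))ˣ) : ZMod (p ^ m)).val *
            (1 + b * (p : ℤ) ^ (m - r)) [ZMOD (p : ℤ) ^ m] ∧
        (p : ℤ) ^ r ∣ (p : ℤ) ^ (m - r) * (b * (b - 1)) := by
  have hx := alphaTilde_mul_deltaTilde_x (n := n) hp.pos hr hrm u a d
  have hy := alphaTilde_mul_deltaTilde_y (n := n) hp.pos hr hrm u a d
  refine exists_antihom_equivariant_iff hp hp2 hr hrn hrm hmn hx hy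
    (alphaUnit_zpow_val_modEq_one hp hrm hu a) (deltaUnit_zpow_val_modEq_one hp hr hrn d) ?_
  have h1 : (alphaUnit p m r u ^ a) ^ p ^ r = 1 := by
    rw [← zpow_natCast, zpow_comm, zpow_natCast, ← orderOf_alphaUnit hp hrm hu, pow_orderOf_eq_one,
      one_zpow]
  have h2 : (deltaUnit p n r hr ^ d) ^ p ^ r = 1 := by
    have h3 : deltaUnit p n r hr ^ p ^ r = 1 := by
      rw [← orderOf_dvd_iff_pow_eq_one, orderOf_deltaUnit hp hp2 hr hrn]
      exact pow_dvd_pow p (by omega)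
    rw [← zpow_natCast, zpow_comm, zpow_natCast, h3, one_zpow]
  -- In `ZMod 1` the value of 1 is 0, so the trivial modulus has to be split off and is excluded
  -- below.
  have hq (q : ℕ) (g : G p m n r) : g ^ ((1 : (ZMod q)ˣ) : ZMod q).val = g ∨ q = 1 := by
    rcases eq_or_ne q 1 with h | h
    · exact Or.inr h
    · left
      rw [Units.val_one, ZMod.val_one'' h, pow_one]
  rw [← zpow_natCast (_ * _)]
  apply mulAut_ext
  · rw [zpow_apply_of_apply_eq_pow x_pow hx, zpow_natCast, h1, MulAut.one_apply]
    exact (hq _ _).resolve_right (Nat.one_lt_pow (by omega) hp.one_lt).ne'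
  · rw [zpow_apply_of_apply_eq_pow y_pow hy, zpow_natCast, h2, MulAut.one_apply]
    exact (hq _ _).resolve_right (Nat.one_lt_pow (by omega) hp.one_lt).ne'

end LargeN

theorem y_pow_eq_iff (hp : p.Prime) (hp2 : p ≠ 2) (hrn : r ≤ n) (hrm : r < m) {l l' : ℕ} :
    y p m n r ^ l = y p m n r ^ l' ↔ l ≡ l' [MOD p ^ n] := by
  simpa [Int.ModEq.refl] using
    x_zpow_mul_y_pow_eq_iff hp hp2 hrn hrm (k := 0) (k' := 0) (l := l) (l' := l')

theorem val_modEq_val_iff {q : ℕ} [NeZero q] {v v' : (ZMod q)ˣ} :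
    (v : ZMod q).val ≡ (v' : ZMod q).val [MOD q] ↔ v = v' := by
  rw [← ZMod.natCast_eq_natCast_iff, ZMod.natCast_zmod_val, ZMod.natCast_zmod_val, Units.val_inj]

theorem x_pow_val_eq_iff (hp : p.Prime) (hp2 : p ≠ 2) (hrn : r ≤ n) (hrm : r < m)
    {v v' : (ZMod (p ^ m))ˣ} :
    x p m n r ^ (v : ZMod (p ^ m)).val = x p m n r ^ (v' : ZMod (p ^ m)).val ↔ v = v' := by
  have : NeZero (p ^ m) := ⟨pow_ne_zero _ hp.ne_zero⟩
  rw [← zpow_natCast, ← zpow_natCast, x_zpow_eq_iff hp hp2 hrn hrm, ← val_modEq_val_iff,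
    ← Int.natCast_modEq_iff]
  push_cast
  rfl

theorem y_pow_val_eq_iff (hp : p.Prime) (hp2 : p ≠ 2) (hrn : r ≤ n) (hrm : r < m)
    {v v' : (ZMod (p ^ n))ˣ} :
    y p m n r ^ (v : ZMod (p ^ n)).val = y p m n r ^ (v' : ZMod (p ^ n)).val ↔ v = v' := by
  have : NeZero (p ^ n) := ⟨pow_ne_zero _ hp.ne_zero⟩
  rw [y_pow_eq_iff hp hp2 hrn hrm, val_modEq_val_iff]

/-! ### The case n ≤ m - r. -/

section SmallN

theorem conj_y_zpow_x (hp : p.Prime) (hrm : r < m) (k : ℤ) :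
    (MulAut.conj (y p m n r) ^ k) (x p m n r) =
      x p m n r ^ ((oneAddPow p m (m - r) (by omega) ^ k : (ZMod (p ^ m))ˣ) : ZMod (p ^ m)).val := by
  have : NeZero (p ^ m) := ⟨pow_ne_zero _ hp.ne_zero⟩
  refine zpow_apply_of_apply_eq_pow x_pow ?_ k
  rw [MulAut.conj_apply, conj_x]
  apply x_pow_congr
  rw [← ZMod.natCast_eq_natCast_iff, ZMod.natCast_zmod_val, coe_oneAddPow]
  push_cast
  rfl

theorem conj_y_zpow_y (k : ℤ) : (MulAut.conj (y p m n r) ^ k) (y p m n r) = y p m n r :=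
  zpow_apply_of_apply_eq_self (by simp) k

/-- The commutator of x and y is a power of x^(p^(m-r)), which commutes with y because 2(m-r) ≥ m.
-/
theorem commute_conj_x_conj_y (hrm : r < m) (hrmr : r ≤ m - r) :
    Commute (MulAut.conj (x p m n r)) (MulAut.conj (y p m n r)) := by
  have h := conj_x_zpow_y (p := p) (m := m) (n := n) (r := r) 1
  have h2 := y_pow_mul_x_zpow (p := p) (m := m) (n := n) (r := r) 1 (-1 * (p : ℤ) ^ (m - r))
  rw [zpow_one] at h
  rw [pow_one, pow_one] at h2
  apply mulAut_ext
  · simp only [MulAut.mul_apply, MulAut.conj_apply]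
    rw [mul_inv_cancel_right, conj_x, ← pow_succ', pow_succ, mul_inv_cancel_right]
  · simp only [MulAut.mul_apply, MulAut.conj_apply]
    rw [mul_inv_cancel_right, h, ← mul_assoc, h2, mul_inv_cancel_right]
    congr 1
    apply x_zpow_congr
    refine Int.modEq_iff_dvd.mpr ((pow_dvd_pow (p : ℤ) (show m ≤ m - r + (m - r) by omega)).trans ?_)
    exact ⟨-1, by ring⟩

theorem commute_conj (hp : 0 < p) (hrm : r < m) (hrmr : r ≤ m - r) (g h : G p m n r) :
    Commute (MulAut.conj g) (MulAut.conj h) := by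
  have hc := commute_conj_x_conj_y (p := p) (n := n) hrm hrmr
  obtain ⟨k, l, rfl⟩ := exists_eq_x_zpow_mul_y_pow hp g
  obtain ⟨k', l', rfl⟩ := exists_eq_x_zpow_mul_y_pow hp h
  simp only [map_mul, map_zpow, map_pow]
  refine Commute.mul_left (Commute.mul_right ?_ ?_) (Commute.mul_right ?_ ?_)
  · exact (Commute.refl _).zpow_zpow _ _
  · exact (hc.zpow_left _).pow_right _
  · exact (hc.symm.zpow_right _).pow_left _
  · exact (Commute.refl _).pow_pow _ _

/-- The endomorphism `x ↦ x y ^ k`, `y ↦ y`. -/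
def gammaHom (hp : p.Prime) (hp2 : p ≠ 2) (hr : 1 ≤ r) (hrm : r < m) (hn : n ≤ m - r)
    (hrmr : r ≤ m - r) (k : ℕ) : G p m n r →* G p m n r :=
  lift (x p m n r * y p m n r ^ k) (y p m n r)
    (by
      have h := x_zpow_mul_y_pow_pow (p := p) (m := m) (n := n) (r := r) 1 k (p ^ m)
      have h1 := geom_sum_modEq_of_dvd (hp.odd_of_ne_two hp2) (s := m - r) (r := r) (by omega)
        (one_add_pow_pow_modEq_one (p := p) k) (pow_dvd_pow p hrm.le)
      rw [Nat.sub_add_cancel hrm.le] at h1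
      have h2 : y p m n r ^ (k * p ^ m) = y p m n r ^ 0 :=
        y_pow_congr (Nat.modEq_zero_iff_dvd.mpr ((pow_dvd_pow p (by omega)).mul_left k))
      rw [one_mul, zpow_one] at h
      rw [h, x_zpow_congr h1, zpow_natCast, x_pow, one_mul, h2, pow_zero])
    y_pow
    (by
      -- Divisibility of p^(m-r) by p^r lets the power be taken factor by factor; divisibility by
      -- p^n then leaves y^k unchanged.
      have hN : p ^ (m - r) ≡ 0 [MOD p ^ r] := Nat.modEq_zero_iff_dvd.mpr (pow_dvd_pow p hrmr)
      have h := x_zpow_mul_y_pow_pow_of_modEq (n := n) hp hp2 hr hrm 1 k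
        (w := 1 + p ^ (m - r)) (by simpa using hN.add_left 1)
      have h2 : y p m n r ^ (k * (1 + p ^ (m - r))) = y p m n r ^ k := by
        apply y_pow_congr
        have h3 : p ^ (m - r) ≡ 0 [MOD p ^ n] := Nat.modEq_zero_iff_dvd.mpr (pow_dvd_pow p hn)
        simpa using (h3.add_left 1).mul_left k
      rw [zpow_one, one_mul, h2, zpow_natCast] at h
      rw [h, ← mul_assoc, mul_inv_eq_iff_eq_mul, mul_inv_eq_iff_eq_mul.mp conj_x, mul_assoc,
        mul_assoc, ← pow_succ, ← pow_succ'])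

theorem gammaHom_comp (hp : p.Prime) (hp2 : p ≠ 2) (hr : 1 ≤ r) (hrm : r < m) (hn : n ≤ m - r)
    (hrmr : r ≤ m - r) {k l : ℕ} (h : k + l ≡ 0 [MOD p ^ n]) :
    (gammaHom hp hp2 hr hrm hn hrmr k).comp (gammaHom hp hp2 hr hrm hn hrmr l) =
      MonoidHom.id _ := by
  apply hom_ext
  · simp [gammaHom, mul_assoc, ← pow_add, y_pow_congr h]
  · simp [gammaHom]

/-- The automorphism `x ↦ x y`, `y ↦ y`. -/
def gamma (hp : p.Prime) (hp2 : p ≠ 2) (hr : 1 ≤ r) (hrm : r < m) (hn : n ≤ m - r)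
    (hrmr : r ≤ m - r) : MulAut (G p m n r) :=
  have hpn : 1 ≤ p ^ n := Nat.one_le_pow _ _ hp.pos
  MonoidHom.toMulEquiv (gammaHom hp hp2 hr hrm hn hrmr 1)
    (gammaHom hp hp2 hr hrm hn hrmr (p ^ n - 1))
    (gammaHom_comp hp hp2 hr hrm hn hrmr (by
      rw [Nat.sub_add_cancel hpn]
      exact Nat.modEq_zero_iff_dvd.mpr dvd_rfl))
    (gammaHom_comp hp hp2 hr hrm hn hrmr (by
      rw [Nat.add_sub_cancel' hpn]
      exact Nat.modEq_zero_iff_dvd.mpr dvd_rfl))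

/-- Equivariance at x under `gamma` equates η conj(x)^(-b) with conj(x y)^(-b), which splits since
inner automorphisms commute. Conversely σ ↦ conj(σ)^(-b) is equivariant, and commutativity makes it
an antihomomorphism. -/
theorem exists_antihom_equivariant_iff_eq_conj (hp : p.Prime) (hp2 : p ≠ 2) (hr : 1 ≤ r)
    (hrn : r ≤ n) (hrm : r < m) (hn : n ≤ m - r) (η : MulAut (G p m n r)) (b : ℤ) :
    (∃ Γ : G p m n r → MulAut (G p m n r), IsAntihom Γ ∧
      Γ (x p m n r) = betaTilde p m n r hrm ^ b ∧ Γ (y p m n r) = η ∧ IsEquivariant Γ) ↔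
      η = MulAut.conj (y p m n r) ^ (-b) := by
  have hrmr : r ≤ m - r := hrn.trans hn
  rw [betaTilde_zpow hrm hrn, map_zpow]
  constructor
  · rintro ⟨Γ, hΓ, hx, hy, heq⟩
    have hgx : gamma hp hp2 hr hrm hn hrmr (x p m n r) = x p m n r * y p m n r := by
      simp [gamma, gammaHom, MonoidHom.toMulEquiv_apply]
    have h1 := heq (gamma hp hp2 hr hrm hn hrmr) (x p m n r)
    rw [hgx, hΓ, hx, hy, ← conj_zpow, mulAut_mul_conj_mul_inv, hgx, map_mul,
      (commute_conj_x_conj_y hrm hrmr).mul_zpow,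
      ((commute_conj_x_conj_y hrm hrmr).zpow_zpow (-b) (-b)).eq] at h1
    exact mul_right_cancel h1
  · rintro rfl
    refine ⟨fun g => MulAut.conj g ^ (-b), ?_, rfl, rfl, ?_⟩
    · intro σ τ
      have hc := commute_conj hp.pos hrm hrmr σ τ
      beta_reduce
      rw [map_mul, hc.mul_zpow, (hc.zpow_zpow (-b) (-b)).eq]
    · intro φ σ
      beta_reduce
      rw [← mulAut_mul_conj_mul_inv, conj_zpow]

theorem admissible_iff_of_le_sub (hp : p.Prime) (hp2 : p ≠ 2) (hr : 1 ≤ r) (hrn : r ≤ n)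
    (hrm : r < m) (hn : n ≤ m - r) (u : (ZMod (p ^ m))ˣ) (a b d : ℤ) :
    Admissible p m n r hp.pos hr hrm u (a, b, d) ↔
      deltaUnit p n r hr ^ d = 1 ∧
        alphaUnit p m r u ^ a = oneAddPow p m (m - r) (by omega) ^ (-b) := by
  refine (exists_antihom_equivariant_iff_eq_conj hp hp2 hr hrn hrm hn _ b).trans ?_
  have hone : y p m n r = y p m n r ^ ((1 : (ZMod (p ^ n))ˣ) : ZMod (p ^ n)).val := by
    rw [Units.val_one, ZMod.val_one'' (Nat.one_lt_pow (by omega) hp.one_lt).ne', pow_one]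
  have hx := alphaTilde_mul_deltaTilde_x (n := n) hp.pos hr hrm u a d
  have hy := alphaTilde_mul_deltaTilde_y (n := n) hp.pos hr hrm u a d
  constructor
  · intro h
    rw [h] at hx hy
    rw [conj_y_zpow_x hp hrm, x_pow_val_eq_iff hp hp2 hrn hrm] at hx
    rw [conj_y_zpow_y] at hy
    exact ⟨((y_pow_val_eq_iff hp hp2 hrn hrm).mp (hone.symm.trans hy)).symm, hx.symm⟩
  · rintro ⟨h1, h2⟩
    rw [h2, ← conj_y_zpow_x hp hrm] at hx
    rw [h1, ← hone] at hy
    exact mulAut_ext hx (hy.trans (conj_y_zpow_y _).symm)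

end SmallN

/-! ### Tools for counting classes and residues. -/

section Counting

/-- Allows classes modulo `modulus` to be counted through whichever coordinates determine them on
admissible triplets. -/
theorem ncard_image_eq_ncard_image {α β γ : Type*} {S : Set α} {f : α → β} {g : α → γ}
    (h : ∀ s ∈ S, ∀ t ∈ S, f s = f t ↔ g s = g t) : (f '' S).ncard = (g '' S).ncard := by
  choose k hkS hk using fun (b : β) (hb : b ∈ f '' S) => hb
  refine Set.ncard_congr (fun b hb => g (k b hb)) (fun b hb => ⟨k b hb, hkS b hb, rfl⟩) ?_ ?_
  · intro b b' hb hb' hbb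
    rw [← hk b hb, ← hk b' hb']
    exact (h _ (hkS b hb) _ (hkS b' hb')).mpr hbb
  · rintro _ ⟨s, hs, rfl⟩
    have hfs := Set.mem_image_of_mem f hs
    exact ⟨f s, hfs, (h _ (hkS _ hfs) _ hs).mp (hk _ hfs)⟩

theorem coe_eq_coe_iff_modEq {a b d a' b' d' : ℤ} :
    (((a, b, d) : ℤ × ℤ × ℤ) : (ℤ × ℤ × ℤ) ⧸ modulus p n r) =
        (((a', b', d') : ℤ × ℤ × ℤ) : (ℤ × ℤ × ℤ) ⧸ modulus p n r) ↔
      a ≡ a' [ZMOD (p : ℤ) ^ r] ∧ b ≡ b' [ZMOD (p : ℤ) ^ r] ∧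
        d ≡ d' [ZMOD (p : ℤ) ^ min r (n - r)] := by
  rw [QuotientAddGroup.eq]
  simp only [modulus, AddSubgroup.mem_prod, Int.mem_zmultiples_iff, Int.modEq_iff_dvd,
    neg_add_eq_sub, Prod.fst_sub, Prod.snd_sub]

theorem exists_unit_coe_eq (hp : p.Prime) {s : ℕ} (hs : 1 ≤ s) (hsm : s ≤ m) (b : ℤ) :
    ∃ c ∈ (ZMod.unitsMap (pow_dvd_pow p hsm)).ker,
      (c : ZMod (p ^ m)) = ((1 + b * (p : ℤ) ^ s : ℤ) : ZMod (p ^ m)) := by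
  have hcop : IsCoprime (1 + b * (p : ℤ) ^ s) ((p ^ m : ℕ) : ℤ) := by
    push_cast
    refine (IsCoprime.pow_left ((Nat.prime_iff_prime_int.mp hp).coprime_iff_not_dvd.mpr ?_)).symm
    intro h
    have h1 : (p : ℤ) ∣ b * p ^ s := (dvd_pow_self _ (by omega)).mul_left b
    exact (Nat.prime_iff_prime_int.mp hp).not_dvd_one ((dvd_add_left h1).mp h)
  refine ⟨ZMod.unitOfIsCoprime _ hcop, ?_, ZMod.coe_unitOfIsCoprime _ _⟩
  rw [MonoidHom.mem_ker]
  ext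
  rw [ZMod.unitsMap_val, ZMod.coe_unitOfIsCoprime, ZMod.cast_intCast (pow_dvd_pow p hsm)]
  have h0 : ((p ^ s : ℕ) : ZMod (p ^ s)) = 0 := ZMod.natCast_self _
  push_cast at h0 ⊢
  rw [h0, mul_zero, add_zero]

/-- Puts the congruence on w and s into the unit group modulo p^m, where it can be solved for the
power of `alphaUnit`. -/
theorem val_modEq_iff_unitsMap_eq (hp : p.Prime) (hmn : m ≤ n) {W : (ZMod (p ^ n))ˣ}
    {S c : (ZMod (p ^ m))ˣ} {k : ℤ} (hc : (c : ZMod (p ^ m)) = (k : ZMod (p ^ m))) :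
    ((W : ZMod (p ^ n)).val : ℤ) ≡ (S : ZMod (p ^ m)).val * k [ZMOD (p : ℤ) ^ m] ↔
      ZMod.unitsMap (pow_dvd_pow p hmn) W = S * c := by
  have : NeZero (p ^ m) := ⟨pow_ne_zero _ hp.ne_zero⟩
  have : NeZero (p ^ n) := ⟨pow_ne_zero _ hp.ne_zero⟩
  rw [← Units.val_inj, Units.val_mul, ZMod.unitsMap_val, hc, ← ZMod.natCast_val,
    ← Nat.cast_pow, ← ZMod.intCast_eq_intCast_iff]
  push_cast
  rw [ZMod.natCast_zmod_val]

theorem ncard_fiber_castHom (hp : p.Prime) {e : ℕ} (her : e ≤ r) (c : ZMod (p ^ e)) :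
    {β : ZMod (p ^ r) | ZMod.castHom (pow_dvd_pow p her) (ZMod (p ^ e)) β = c}.ncard =
      p ^ (r - e) := by
  have : NeZero (p ^ r) := ⟨pow_ne_zero _ hp.ne_zero⟩
  set f := (ZMod.castHom (pow_dvd_pow p her) (ZMod (p ^ e))).toAddMonoidHom with hf
  have hsurj : Function.Surjective f := ZMod.castHom_surjective (pow_dvd_pow p her)
  obtain ⟨γ, hγ⟩ := hsurj c
  have h1 : {β : ZMod (p ^ r) | ZMod.castHom (pow_dvd_pow p her) (ZMod (p ^ e)) β = c} =
      (fun β => γ + β) '' (f.ker : Set (ZMod (p ^ r))) := by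
    ext β
    constructor
    · intro hβ
      refine ⟨-γ + β, ?_, by simp⟩
      have hβ' : f β = c := hβ
      rw [SetLike.mem_coe, AddMonoidHom.mem_ker, map_add, map_neg, hγ, hβ', neg_add_cancel]
    · rintro ⟨δ, hδ, rfl⟩
      change f (γ + δ) = c
      rw [map_add, hγ, hδ, add_zero]
  rw [h1, Set.ncard_image_of_injective _ (add_right_injective γ)]
  have h2 := AddSubgroup.card_mul_index f.ker
  rw [AddSubgroup.index_ker, AddMonoidHom.range_eq_top.mpr hsurj, AddSubgroup.card_top,
    Nat.card_zmod, Nat.card_zmod] at h2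
  exact Nat.eq_of_mul_eq_mul_right (pow_pos hp.pos e) (h2.trans (pow_sub_mul_pow p her).symm)

/-- The prime p divides at most one of b and b - 1, so that factor absorbs the whole power. -/
theorem dvd_mul_sub_one_iff (hp : p.Prime) (e : ℕ) (b : ℤ) :
    (p : ℤ) ^ e ∣ b * (b - 1) ↔ (p : ℤ) ^ e ∣ b ∨ (p : ℤ) ^ e ∣ b - 1 := by
  have hp' := Nat.prime_iff_prime_int.mp hp
  constructor
  · intro h
    by_cases hb : (p : ℤ) ∣ b
    · left
      refine (IsCoprime.pow_left (hp'.coprime_iff_not_dvd.mpr fun h1 => ?_)).dvd_of_dvd_mul_right h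
      exact hp'.not_dvd_one ((dvd_sub_right hb).mp h1)
    · right
      exact (IsCoprime.pow_left (hp'.coprime_iff_not_dvd.mpr hb)).dvd_of_dvd_mul_left h
  · rintro (h | h)
    · exact h.mul_right _
    · exact h.mul_left _

/-- The residues modulo `p ^ r` of the integers `b` with `p ^ r ∣ p ^ s b (b - 1)`. -/
def relationResidues (p r s : ℕ) : Set (ZMod (p ^ r)) :=
  (fun b : ℤ => (b : ZMod (p ^ r))) '' {b | (p : ℤ) ^ r ∣ (p : ℤ) ^ s * (b * (b - 1))}

theorem ncard_relationResidues_of_le {s : ℕ} (hrs : r ≤ s) :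
    (relationResidues p r s).ncard = p ^ r := by
  have : relationResidues p r s = Set.univ := by
    refine Set.eq_univ_of_forall fun β => ?_
    obtain ⟨b, rfl⟩ := ZMod.intCast_surjective β
    exact ⟨b, (pow_dvd_pow _ hrs).mul_right _, rfl⟩
  rw [this, Set.ncard_univ, Nat.card_zmod]

/-- Cancelling p^s leaves b ≡ 0 or 1 modulo p^(r-s). These are two distinct classes, each with p^s
lifts modulo p^r. -/
theorem ncard_relationResidues_of_lt (hp : p.Prime) {s : ℕ} (hrs : s < r) :
    (relationResidues p r s).ncard = 2 * p ^ s := by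
  have : NeZero (p ^ r) := ⟨pow_ne_zero _ hp.ne_zero⟩
  have her : r - s ≤ r := by omega
  have h1 : relationResidues p r s =
      {β | ZMod.castHom (pow_dvd_pow p her) (ZMod (p ^ (r - s))) β = 0} ∪
        {β | ZMod.castHom (pow_dvd_pow p her) (ZMod (p ^ (r - s))) β = 1} := by
    have key (b : ℤ) : (p : ℤ) ^ r ∣ (p : ℤ) ^ s * (b * (b - 1)) ↔
        (b : ZMod (p ^ (r - s))) = 0 ∨ (b : ZMod (p ^ (r - s))) = 1 := by
      have hpr : (p : ℤ) ^ r = p ^ s * p ^ (r - s) := by rw [← pow_add]; congr 1; omega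
      have hb := ZMod.intCast_zmod_eq_zero_iff_dvd b (p ^ (r - s))
      have hb1 := ZMod.intCast_zmod_eq_zero_iff_dvd (b - 1) (p ^ (r - s))
      push_cast at hb hb1
      rw [sub_eq_zero] at hb1
      rw [hpr, mul_dvd_mul_iff_left (pow_ne_zero _ (by exact_mod_cast hp.ne_zero)),
        dvd_mul_sub_one_iff hp, hb, hb1]
    ext β
    constructor
    · rintro ⟨b, hb, rfl⟩
      simpa [-ZMod.castHom_apply] using (key b).mp hb
    · intro hβ
      obtain ⟨b, rfl⟩ := ZMod.intCast_surjective β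
      exact ⟨b, (key b).mpr (by
        rw [← map_intCast (ZMod.castHom (pow_dvd_pow p her) (ZMod (p ^ (r - s)))) b]
        exact hβ), rfl⟩
  have hdisj : Disjoint {β | ZMod.castHom (pow_dvd_pow p her) (ZMod (p ^ (r - s))) β = 0}
      {β | ZMod.castHom (pow_dvd_pow p her) (ZMod (p ^ (r - s))) β = 1} := by
    rw [Set.disjoint_left]
    intro β h0 h2
    have : Fact (1 < p ^ (r - s)) := ⟨Nat.one_lt_pow (by omega) hp.one_lt⟩
    exact zero_ne_one (h0.symm.trans h2)
  rw [h1, Set.ncard_union_eq hdisj, ncard_fiber_castHom hp her, ncard_fiber_castHom hp her,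
    show r - (r - s) = s by omega, two_mul]

end Counting

/-! ### The number of admissible classes. -/

theorem ncard_admissibleClasses_of_le (hp : p.Prime) (hp2 : p ≠ 2) (hr : 1 ≤ r) (hrn : r ≤ n)
    (hrm : r < m) (hmn : m ≤ n) {u : (ZMod (p ^ m))ˣ} (hu : Subgroup.zpowers u = ⊤) :
    (admissibleClasses p m n r hp.pos hr hrm u).ncard =
      (relationResidues p r (m - r)).ncard * p ^ min r (n - r) := by
  choose c hcker hc using exists_unit_coe_eq (m := m) hp (show 1 ≤ m - r by omega) (by omega)
  have hadm (a b d : ℤ) : Admissible p m n r hp.pos hr hrm u (a, b, d) ↔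
      ZMod.unitsMap (pow_dvd_pow p hmn) (deltaUnit p n r hr ^ d) = alphaUnit p m r u ^ a * c b ∧
        (p : ℤ) ^ r ∣ (p : ℤ) ^ (m - r) * (b * (b - 1)) := by
    rw [admissible_iff_of_le hp hp2 hr hrn hrm hmn hu, val_modEq_iff_unitsMap_eq hp hmn (hc b)]
  have hcongr {b b' : ℤ} (h : b ≡ b' [ZMOD (p : ℤ) ^ r]) : c b = c b' := by
    ext
    rw [hc, hc, ZMod.intCast_eq_intCast_iff]
    push_cast
    have h1 := (h.mul_right' (c := (p : ℤ) ^ (m - r))).add_left 1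
    rwa [← pow_add, show r + (m - r) = m by omega] at h1
  -- On admissible triplets b and d determine a, so the class is recorded by the residues of b and
  -- d.
  let g : ℤ × ℤ × ℤ → ZMod (p ^ r) × ZMod (p ^ min r (n - r)) := fun t => (t.2.1, t.2.2)
  have hg : ∀ s ∈ {t | Admissible p m n r hp.pos hr hrm u t},
      ∀ t ∈ {t | Admissible p m n r hp.pos hr hrm u t},
      (s : (ℤ × ℤ × ℤ) ⧸ modulus p n r) = t ↔ g s = g t := by
    rintro ⟨a, b, d⟩ hs ⟨a', b', d'⟩ ht
    rw [Set.mem_ofPred_eq, hadm] at hs ht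
    simp only [g, coe_eq_coe_iff_modEq, Prod.mk.injEq, ZMod.intCast_eq_intCast_iff, Nat.cast_pow]
    refine ⟨fun h => h.2, fun h => ⟨?_, h⟩⟩
    have hd : deltaUnit p n r hr ^ d = deltaUnit p n r hr ^ d' := by
      rw [zpow_eq_zpow_iff_modEq, orderOf_deltaUnit hp hp2 hr hrn]
      exact_mod_cast h.2
    have h1 := hs.1
    rw [hd, ht.1, hcongr h.1] at h1
    exact (alphaUnit_zpow_eq_iff hp hrm hu).mp (mul_right_cancel h1).symm
  have himage : g '' {t | Admissible p m n r hp.pos hr hrm u t} =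
      relationResidues p r (m - r) ×ˢ Set.univ := by
    ext ⟨β, δ⟩
    simp only [Set.mem_image, Set.mem_prod, Set.mem_univ, and_true]
    constructor
    · rintro ⟨⟨a, b, d⟩, ht, hβ⟩
      rw [Set.mem_ofPred_eq, hadm] at ht
      exact ⟨b, ht.2, congrArg Prod.fst hβ⟩
    · rintro ⟨b, hb, rfl⟩
      obtain ⟨d, rfl⟩ := ZMod.intCast_surjective δ
      -- The unit required of α̃^a is 1 modulo p^(m-r): this holds for c b by construction and for
      -- the δ̃ factor because m - r ≤ n - r. Such units are exactly the powers of `alphaUnit`.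
      have hmem : ZMod.unitsMap (pow_dvd_pow p hmn) (deltaUnit p n r hr ^ d) * (c b)⁻¹ ∈
          Subgroup.zpowers (alphaUnit p m r u) := by
        rw [alphaUnit, zpowers_pow_eq_ker hp (by omega) (by omega) hu]
        refine Subgroup.mul_mem _ ?_ (Subgroup.inv_mem _ (hcker b))
        rw [MonoidHom.mem_ker, ← MonoidHom.comp_apply, ZMod.unitsMap_comp, ← MonoidHom.mem_ker,
          mem_ker_unitsMap_iff hp (by omega)]
        exact (deltaUnit_zpow_val_modEq_one hp hr hrn d).of_dvd (pow_dvd_pow p (by omega))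
      obtain ⟨a, ha⟩ := Subgroup.mem_zpowers_iff.mp hmem
      exact ⟨(a, b, d), (hadm a b d).mpr ⟨by rw [ha, inv_mul_cancel_right], hb⟩, rfl⟩
  rw [admissibleClasses, ncard_image_eq_ncard_image hg, himage, Set.ncard_prod, Set.ncard_univ,
    Nat.card_zmod]

theorem ncard_admissibleClasses_of_le_sub (hp : p.Prime) (hp2 : p ≠ 2) (hr : 1 ≤ r)
    (hrn : r ≤ n) (hrm : r < m) (hn : n ≤ m - r) {u : (ZMod (p ^ m))ˣ}
    (hu : Subgroup.zpowers u = ⊤) :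
    (admissibleClasses p m n r hp.pos hr hrm u).ncard = p ^ r := by
  have hZ : orderOf (oneAddPow p m (m - r) (by omega)) = p ^ r := by
    rw [orderOf_oneAddPow hp hp2 _ (by omega)]
    congr 1
    omega
  -- Here b alone determines the class: a through the power of 1 + p^(m-r), and d because δ̃^d must
  -- be trivial.
  let g : ℤ × ℤ × ℤ → ZMod (p ^ r) := fun t => t.2.1
  have hg : ∀ s ∈ {t | Admissible p m n r hp.pos hr hrm u t},
      ∀ t ∈ {t | Admissible p m n r hp.pos hr hrm u t},
      (s : (ℤ × ℤ × ℤ) ⧸ modulus p n r) = t ↔ g s = g t := by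
    rintro ⟨a, b, d⟩ hs ⟨a', b', d'⟩ ht
    rw [Set.mem_ofPred_eq, admissible_iff_of_le_sub hp hp2 hr hrn hrm hn] at hs ht
    simp only [g, coe_eq_coe_iff_modEq, ZMod.intCast_eq_intCast_iff, Nat.cast_pow]
    refine ⟨fun h => h.2.1, fun h => ⟨?_, h, ?_⟩⟩
    · rw [← alphaUnit_zpow_eq_iff hp hrm hu, hs.2, ht.2, zpow_eq_zpow_iff_modEq, hZ]
      exact_mod_cast h.neg
    · have h1 := hs.1.trans ht.1.symm
      rw [zpow_eq_zpow_iff_modEq, orderOf_deltaUnit hp hp2 hr hrn] at h1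
      exact_mod_cast h1
  have himage : g '' {t | Admissible p m n r hp.pos hr hrm u t} = Set.univ := by
    refine Set.eq_univ_of_forall fun β => ?_
    obtain ⟨b, rfl⟩ := ZMod.intCast_surjective β
    have hmem : oneAddPow p m (m - r) (by omega) ^ (-b) ∈ Subgroup.zpowers (alphaUnit p m r u) := by
      rw [alphaUnit, zpowers_pow_eq_ker hp (by omega) (by omega) hu]
      exact Subgroup.zpow_mem _ (oneAddPow_mem_ker _ (by omega)) _
    obtain ⟨a, ha⟩ := Subgroup.mem_zpowers_iff.mp hmem
    exact ⟨(a, b, 0),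
      (admissible_iff_of_le_sub hp hp2 hr hrn hrm hn u a b 0).mpr ⟨zpow_zero _, ha⟩, rfl⟩
  rw [admissibleClasses, ncard_image_eq_ncard_image hg, himage, Set.ncard_univ, Nat.card_zmod]

end Metacyclic

theorem proposition4p1 (p m n r : ℕ) (hp : p.Prime) (hp2 : p ≠ 2) (hm : 2 ≤ m) (hn : 1 ≤ n)
    (hr : 1 ≤ r) (hrn : r ≤ n) (hrm : r < m)
    (u : (ZMod (p ^ m))ˣ) (hu : Subgroup.zpowers u = ⊤) :
    (m ≤ n → m - r < r →
      (Metacyclic.admissibleClasses p m n r hp.pos hr hrm u).ncard =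
        2 * p ^ (m - r + min r (n - r))) ∧
    (m ≤ n → r ≤ m - r →
      (Metacyclic.admissibleClasses p m n r hp.pos hr hrm u).ncard =
        p ^ (r + min r (n - r))) ∧
    (n ≤ m - r →
      (Metacyclic.admissibleClasses p m n r hp.pos hr hrm u).ncard = p ^ r) := by
  refine ⟨fun hmn h => ?_, fun hmn h => ?_, fun h => ?_⟩
  · rw [Metacyclic.ncard_admissibleClasses_of_le hp hp2 hr hrn hrm hmn hu,
      Metacyclic.ncard_relationResidues_of_lt hp h, mul_assoc, ← pow_add]
  · rw [Metacyclic.ncard_admissibleClasses_of_le hp hp2 hr hrn hrm hmn hu,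
      Metacyclic.ncard_relationResidues_of_le h, ← pow_add]
  · exact Metacyclic.ncard_admissibleClasses_of_le_sub hp hp2 hr hrn hrm h hu
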